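/- All logarithms are to base $2$. A sequence $x^n=(x_1,\dots,x_n)$ consists of positive integers. A code for such sequences is represented by its real-valued length function $L$ in bits (integer length constraints are ignored), subject to Kraft's inequality $\sum_{x^n}2^{-L(x^n)}\le 1$. Let $\mathcal M$ be the class of monotonic distributions $\theta_1\ge\theta_2\ge\cdots\ge 0$, $\sum_i\theta_i=1$, on the positive integers. The individual sequence redundancy of $L$ with respect to the monotonic maximum likelihood description length of $x^n$ is $$\hat R_n(L,x^n)=\frac1n\Big\{L(x^n)+\log\max_{\theta\in\mathcal M}\prod_{t=1}^n\theta_{x_t}\Big\}.$$ For $\varepsilon>0$, a function $b$ with $b(n)=o(\sqrt n)$ (which makes the region "$m=o(\sqrt n)$" precise), $\rho>\varepsilon$ and $m=n^\rho$, let $$\hat{\mathcal R}_n(m)=\begin{cases}\dfrac{m-1}{2}\log\dfrac nm, & m\le n^{1/3},\\[2mm] m\log\dfrac n{m^2}, & n^{1/3}<m\le b(n),\\[2mm] \min_{\alpha\le\rho-\varepsilon}\Big\{\dfrac{\rho+1+\alpha}{2}(\rho-\alpha)(\log n)^2n^{\alpha}+3(\log e)\,n^{1-\alpha}\Big\}, &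 \text{otherwise.}\end{cases}$$ Theorem 8. For every $\varepsilon>0$ there are codes with length functions $L_n^*$, one for each length $n$, such that for every function $b(n)=o(\sqrt n)$, all sufficiently large $n$, and every $x^n$, $$\hat R_n(L_n^*,x^n)\le\frac{1+\varepsilon}{n}\,\inf_{\rho>\varepsilon}\Big\{\hat{\mathcal R}_n(n^\rho)+\Big(1+\frac1\rho\Big)\sum_{i>n^\rho,\ i\in x^n}\log i\Big\},$$ where the sum runs over the distinct symbols $i>n^\rho$ that occur in $x^n$. -/

import Mathlib

open Filter Asymptotics

noncomputable section

/-- The class of monotonic distributions over the positive integers: probability vectors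
`θ₁ ≥ θ₂ ≥ ⋯ ≥ 0` that sum to `1`. -/
def monotonicDist : Set (ℕ+ → ℝ) :=
  {θ | (∀ i, 0 ≤ θ i) ∧ HasSum θ 1 ∧ Antitone θ}

/-- Probability of the sequence `x` under i.i.d. sampling from `θ`. -/
def seqProb {n : ℕ} (θ : ℕ+ → ℝ) (x : Fin n → ℕ+) : ℝ :=
  ∏ t, θ (x t)

/-- The monotonic maximum likelihood probability of `x`. -/
def monotonicML {n : ℕ} (x : Fin n → ℕ+) : ℝ :=
  ⨆ θ : monotonicDist, seqProb (θ : ℕ+ → ℝ) x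

/-- `L` is the length function (in bits, with integer length constraints ignored) of a uniquely
decodable binary code for the sequences of `n` positive integers: it satisfies Kraft's
inequality. -/
def IsCodeLength {n : ℕ} (L : (Fin n → ℕ+) → ℝ) : Prop :=
  Summable (fun x => (2 : ℝ) ^ (-L x)) ∧ ∑' x, (2 : ℝ) ^ (-L x) ≤ 1

/-- Individual sequence redundancy (per symbol) of `L` on `x` with respect to the monotonic
maximum likelihood description length `-log₂ (monotonicML x)`. -/
def individualRedundancy {n : ℕ} (L : (Fin n → ℕ+) → ℝ) (x : Fin n → ℕ+) : ℝ :=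
  1 / (n : ℝ) * (L x + Real.logb 2 (monotonicML x))

/-- The cost of an effective alphabet of size `m = n ^ ρ`, in three regions.
The middle region is `n ^ (1/3) < m ≤ b n`, where `b` is a function with `b n = o(√n)`. -/
def effectiveAlphabetCost (ε : ℝ) (b : ℕ → ℝ) (n : ℕ) (ρ : ℝ) : ℝ :=
  let m : ℝ := (n : ℝ) ^ ρ
  if m ≤ (n : ℝ) ^ (1 / 3 : ℝ) then
    (m - 1) / 2 * Real.logb 2 (n / m)
  else if m ≤ b n then
    m * Real.logb 2 (n / m ^ 2)
  else
    ⨅ α : Set.Iic (ρ - ε),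
      ((ρ + 1 + (α : ℝ)) / 2 * (ρ - (α : ℝ)) * (Real.logb 2 n) ^ 2 * (n : ℝ) ^ (α : ℝ)
        + 3 * Real.logb 2 (Real.exp 1) * (n : ℝ) ^ (1 - (α : ℝ)))

/-- The sum of `log₂ i` over the distinct symbols `i > n ^ ρ` that occur in `x`. -/
def largeSymbolCost {n : ℕ} (ρ : ℝ) (x : Fin n → ℕ+) : ℝ :=
  ∑ i ∈ (Finset.univ.image x).filter (fun i : ℕ+ => (n : ℝ) ^ ρ < ((i : ℕ) : ℝ)),
    Real.logb 2 ((i : ℕ) : ℝ)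

end

/-! A sub-probability `Q` on sequences is a code of length `-log Q`. In a countable mixture each
component loses only the logarithm of its prior weight, so a single code serves all alphabet sizes
`M` and precisions `D`, and the exponent `ρ` may be chosen after the sequence is seen
(`exists_universal_code`).

For fixed `M`, a component is a two-part code (`exists_subProb_of_parametrization`). Symbols above
`M` are listed with their counts, at about `log n + (1 + κ) log i` nats each. For the others,
quantised weights are described. These need not sum to one: normalisation is paid for by `S ≤ exp (S
- 1)`, which turns the comparison with `θ` into independent comparisons of `θ ^ N * exp (-n θ)`, one
per symbol (`mul_exp_neg_le_iidProb`).

Three quantisers give the three regions. Rounding `√N` up to an integer loses `O(1)` per symbol and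
costs half of `log (n / M)` each. Rounding `n θ` up loses at most 1 per symbol; monotonicity allows
coding successive differences, and the factorial in their scales improves `M log (n / M)` to about
`M log (n / M ^ 2)`. For large `M`, the sizes of the level sets of `θ` are rounded on geometric
grids of ratio `1 + 1 / D`; a monotone staircase of about `2 D log₂ (M D)` bits describes them, with
loss `4 n / D`.

What remains is analysis: overheads linear in `m` fit into the factor `1 + ε`, `D` is taken near `4
n ^ α`, and `i > n ^ ρ` gives `log n ≤ (1 / ρ) log i`. All thresholds on `n` are independent of `ρ`.
-/

open scoped ENNReal

/-! ### Sub-probabilities and geometric codes for integers. -/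

/-- `Q` is a sub-probability mass function. -/
def IsSubProb {X : Type*} (Q : X → ℝ≥0∞) : Prop := ∑' x, Q x ≤ 1

theorem ENNReal.tsum_pi_prod {α : Type*} {K : ℕ} (f : Fin K → α → ℝ≥0∞) :
    ∑' d : Fin K → α, ∏ j, f j (d j) = ∏ j, ∑' a, f j a := by
  induction K with
  | zero => simp
  | succ K ih =>
    rw [← (Fin.consEquiv fun _ => α).tsum_eq, ENNReal.tsum_prod', Fin.prod_univ_succ]
    simp only [Fin.consEquiv_apply, Fin.prod_univ_succ, Fin.cons_zero, Fin.cons_succ]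
    simp only [ENNReal.tsum_mul_left, ENNReal.tsum_mul_right, ih]

theorem IsSubProb.mixture {I X : Type*} {p : I → ℝ≥0∞} {Q : I → X → ℝ≥0∞}
    (hp : IsSubProb p) (hQ : ∀ i, IsSubProb (Q i)) :
    IsSubProb fun x => ∑' i, p i * Q i x := by
  unfold IsSubProb at *
  rw [ENNReal.tsum_comm]
  simp only [ENNReal.tsum_mul_left]
  calc ∑' i, p i * ∑' x, Q i x ≤ ∑' i, p i * 1 := by gcongr with i; exact hQ i
    _ ≤ 1 := by simpa using hp

theorem IsSubProb.prod {I J : Type*} {p : I → ℝ≥0∞} {q : J → ℝ≥0∞}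
    (hp : IsSubProb p) (hq : IsSubProb q) :
    IsSubProb fun x : I × J => p x.1 * q x.2 := by
  unfold IsSubProb at *
  rw [ENNReal.tsum_prod']
  simp only [ENNReal.tsum_mul_left, ENNReal.tsum_mul_right]
  exact mul_le_one' hp hq

theorem IsSubProb.sigma {I : Type*} {J : I → Type*} {p : I → ℝ≥0∞} {q : ∀ i, J i → ℝ≥0∞}
    (hp : IsSubProb p) (hq : ∀ i, IsSubProb (q i)) :
    IsSubProb fun x : Σ i, J i => p x.1 * q x.1 x.2 := by
  unfold IsSubProb at *
  rw [ENNReal.tsum_sigma']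
  simp only [ENNReal.tsum_mul_left]
  calc ∑' i, p i * ∑' x, q i x ≤ ∑' i, p i * 1 := by gcongr with i; exact hq i
    _ ≤ 1 := by simpa using hp

theorem IsSubProb.pi {α : Type*} {K : ℕ} {f : Fin K → α → ℝ≥0∞} (hf : ∀ j, IsSubProb (f j)) :
    IsSubProb fun d : Fin K → α => ∏ j, f j (d j) := by
  unfold IsSubProb at *
  rw [ENNReal.tsum_pi_prod]
  exact Finset.prod_le_one' fun j _ => hf j

theorem isSubProb_of_hasSum {α : Type*} {f : α → ℝ} {a : ℝ} (h0 : ∀ i, 0 ≤ f i)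
    (h : HasSum f a) (ha : a ≤ 1) : IsSubProb fun i => ENNReal.ofReal (f i) := by
  unfold IsSubProb
  rw [← ENNReal.ofReal_tsum_of_nonneg h0 h.summable, h.tsum_eq]
  simpa using ENNReal.ofReal_le_ofReal ha

/-- Length in nats of the geometric code with scale `s`. -/
noncomputable def geomLength (s : ℝ) (k : ℕ) : ℝ := Real.log (1 / s) + (k + 1) * Real.log (1 + s)

/-- The weights are `s (1 + s) ^ (-(k + 1))`, a geometric law of mean `1 / s`; hence `s` is later
set near the reciprocal of the expected size of `k`. -/
theorem isSubProb_geomLength {s : ℝ} (hs : 0 < s) :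
    IsSubProb fun k => ENNReal.ofReal (Real.exp (-geomLength s k)) := by
  refine isSubProb_of_hasSum (a := 1) (fun _ => (Real.exp_pos _).le) ?_ le_rfl
  have h1 : (1 + s)⁻¹ < 1 := inv_lt_one_of_one_lt₀ (by linarith)
  have h := (hasSum_geometric_of_lt_one (r := (1 + s)⁻¹) (by positivity) h1).mul_left (s * (1 + s)⁻¹)
  have h2 : s * (1 + s)⁻¹ * (1 - (1 + s)⁻¹)⁻¹ = 1 := by
    have : 1 - (1 + s)⁻¹ = s * (1 + s)⁻¹ := by field_simp; ring
    rw [this]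
    exact mul_inv_cancel₀ (by positivity)
  rw [h2] at h
  refine h.congr_fun fun k => ?_
  rw [geomLength, show -(Real.log (1 / s) + ((k : ℝ) + 1) * Real.log (1 + s)) =
    Real.log s + ((k + 1 : ℕ) : ℝ) * Real.log (1 + s)⁻¹ by
      rw [one_div, Real.log_inv, Real.log_inv]; push_cast; ring,
    Real.exp_add, Real.exp_nat_mul, Real.exp_log hs, Real.exp_log (by positivity)]
  ring

/-! ### Unnormalised i.i.d. weights, compared symbol by symbol. -/

/-- The i.i.d. law of sequences with symbol probabilities proportional to `φ`. -/
noncomputable def iidProb {n : ℕ} (φ : ℕ → ℝ) (y : Fin n → ℕ) : ℝ≥0∞ :=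
  ∏ t, (ENNReal.ofReal (φ (y t)) / ∑' j, ENNReal.ofReal (φ j))

theorem isSubProb_iidProb (n : ℕ) (φ : ℕ → ℝ) : IsSubProb (iidProb (n := n) φ) := by
  refine IsSubProb.pi (f := fun _ j => ENNReal.ofReal (φ j) / ∑' j, ENNReal.ofReal (φ j)) fun _ => ?_
  unfold IsSubProb
  simp only [div_eq_mul_inv, ENNReal.tsum_mul_right]
  rw [← div_eq_mul_inv]
  exact ENNReal.div_self_le_one

/-- Dividing by the total mass `S` costs at most the factor `exp (S - 1)` per letter. The bound is
exponential in a sum over symbols, hence a product. -/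
theorem le_iidProb {n : ℕ} {φ : ℕ → ℝ} (T : Finset ℕ) (h0 : ∀ j, 0 ≤ φ j)
    (hT : ∀ j, j ∉ T → φ j = 0) (y : Fin n → ℕ) :
    ENNReal.ofReal (Real.exp (n * (1 - ∑ j ∈ T, φ j)) * ∏ t, φ (y t)) ≤ iidProb φ y := by
  have hS : ∑' j, ENNReal.ofReal (φ j) = ENNReal.ofReal (∑ j ∈ T, φ j) := by
    rw [tsum_eq_sum (s := T) (fun j hj => by simp [hT j hj]),
      ENNReal.ofReal_sum_of_nonneg (fun j _ => h0 j)]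
  rw [iidProb, hS]
  set S := ∑ j ∈ T, φ j with hSdef
  have hS0 : 0 ≤ S := Finset.sum_nonneg fun j _ => h0 j
  rw [Real.exp_nat_mul, ← Fin.prod_const, ← Finset.prod_mul_distrib,
    ENNReal.ofReal_prod_of_nonneg (fun t _ => mul_nonneg (Real.exp_pos _).le (h0 _))]
  refine Finset.prod_le_prod' fun t _ => ?_
  rcases hS0.eq_or_lt with h | h
  -- With zero total mass every weight vanishes, so the left side is zero.
  · have : φ (y t) = 0 := by
      by_cases ht : y t ∈ T
      · exact (Finset.sum_eq_zero_iff_of_nonneg fun j _ => h0 j).1 (hSdef.symm.trans h.symm) _ ht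
      · exact hT _ ht
    simp [this]
  · rw [← ENNReal.ofReal_div_of_pos h]
    refine ENNReal.ofReal_le_ofReal ?_
    rw [le_div_iff₀ h]
    have h1 : S ≤ Real.exp (S - 1) := by linarith [Real.add_one_le_exp (S - 1)]
    have h2 : Real.exp (1 - S) * S ≤ 1 := by
      calc Real.exp (1 - S) * S ≤ Real.exp (1 - S) * Real.exp (S - 1) := by gcongr
        _ = 1 := by rw [← Real.exp_add]; simp
    nlinarith [h0 (y t)]

/-- Number of occurrences of `j` in `y`. -/
def occ {n : ℕ} (y : Fin n → ℕ) (j : ℕ) : ℕ := (Finset.univ.filter fun t => y t = j).card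

theorem prod_comp_eq_prod_pow_occ {n : ℕ} (y : Fin n → ℕ) (f : ℕ → ℝ) {T : Finset ℕ}
    (hT : Finset.univ.image y ⊆ T) : ∏ t, f (y t) = ∏ j ∈ T, f j ^ occ y j := by
  rw [Finset.prod_comp f y]
  refine Finset.prod_subset hT fun j _ hj => ?_
  have : (Finset.univ.filter fun t => y t = j).card = 0 := by
    rw [Finset.card_eq_zero, Finset.filter_eq_empty_iff]
    intro t _ h
    exact hj (Finset.mem_image.2 ⟨t, Finset.mem_univ _, h⟩)
  simp [this]

theorem sum_occ_le {n : ℕ} (y : Fin n → ℕ) (T : Finset ℕ) : ∑ j ∈ T, occ y j ≤ n := by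
  unfold occ
  rw [← Finset.card_biUnion]
  · exact (Finset.card_le_univ _).trans (by simp)
  · intro a _ b _ hab
    rw [Function.onFun, Finset.disjoint_left]
    intro t h1 h2
    simp only [Finset.mem_filter] at h1 h2
    exact hab (h1.2.symm.trans h2.2)

/-- If each symbol weight `φ j` is compatible with `θ j` up to a loss `e j`, then the law `φ`
assigns `y` at least its probability under `θ`, up to the total loss. -/
theorem mul_exp_neg_le_iidProb {n : ℕ} {y : Fin n → ℕ} {θ φ e : ℕ → ℝ} (T : Finset ℕ)
    (hT : Finset.univ.image y ⊆ T) (hθ : ∀ j, 0 ≤ θ j) (hθ1 : ∑ j ∈ T, θ j ≤ 1)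
    (h0 : ∀ j, 0 ≤ φ j) (hφ : ∀ j, j ∉ T → φ j = 0)
    (h : ∀ j ∈ T, θ j ^ occ y j * Real.exp (n * φ j) ≤
      φ j ^ occ y j * Real.exp (n * θ j + e j)) :
    ENNReal.ofReal ((∏ t, θ (y t)) * Real.exp (-∑ j ∈ T, e j)) ≤ iidProb φ y := by
  refine le_trans (ENNReal.ofReal_le_ofReal ?_) (le_iidProb T h0 hφ y)
  rw [prod_comp_eq_prod_pow_occ y θ hT, prod_comp_eq_prod_pow_occ y φ hT]
  have h1 := Finset.prod_le_prod
    (fun j _ => mul_nonneg (pow_nonneg (hθ j) _) (Real.exp_pos _).le) h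
  rw [Finset.prod_mul_distrib, Finset.prod_mul_distrib, ← Real.exp_sum, ← Real.exp_sum,
    ← Finset.mul_sum, Finset.sum_add_distrib, ← Finset.mul_sum] at h1
  have hP : 0 ≤ ∏ j ∈ T, φ j ^ occ y j := Finset.prod_nonneg fun j _ => pow_nonneg (h0 j) _
  have h2 : (∏ j ∈ T, θ j ^ occ y j) * Real.exp (n * ∑ j ∈ T, φ j) ≤
      (∏ j ∈ T, φ j ^ occ y j) * Real.exp (n + ∑ j ∈ T, e j) := by
    refine h1.trans (mul_le_mul_of_nonneg_left (Real.exp_le_exp.2 ?_) hP)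
    have : (n : ℝ) * ∑ j ∈ T, θ j ≤ n * 1 := by gcongr
    linarith
  have h3 := mul_le_mul_of_nonneg_right h2
    (Real.exp_pos (-∑ j ∈ T, e j - n * ∑ j ∈ T, φ j)).le
  rw [mul_assoc, mul_assoc, ← Real.exp_add, ← Real.exp_add] at h3
  rw [mul_comm (Real.exp _)]
  rwa [show (n : ℝ) * ∑ j ∈ T, φ j + (-∑ j ∈ T, e j - n * ∑ j ∈ T, φ j) = -∑ j ∈ T, e j by ring,
    show (n : ℝ) + ∑ j ∈ T, e j + (-∑ j ∈ T, e j - n * ∑ j ∈ T, φ j) =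
      n * (1 - ∑ j ∈ T, φ j) by ring] at h3

/-! ### Two-part codes: quantised weights plus a list of large symbols. -/

/-- The law on lists of labelled symbols (as tuples) with independent entries and geometric
length. -/
theorem isSubProb_tuple {α : Type*} {f : α → ℝ≥0∞} (hf : IsSubProb f) :
    IsSubProb fun v : Σ k : ℕ, Fin k → α =>
      ENNReal.ofReal (Real.exp (-geomLength 1 v.1)) * ∏ l, f (v.2 l) :=
  IsSubProb.sigma (isSubProb_geomLength one_pos) fun _ => IsSubProb.pi fun _ => hf

/-- The empirical weights of the symbols listed in `v`. -/
noncomputable def listedWeight (n : ℕ) (v : Σ k : ℕ, Fin k → ℕ × Fin n) (j : ℕ) : ℝ :=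
  ∑ l, if (v.2 l).1 = j then (((v.2 l).2 : ℕ) + 1 : ℝ) / n else 0

theorem isSubProb_pair {n : ℕ} {w : ℕ → ℝ≥0∞} (hw : IsSubProb w) :
    IsSubProb fun a : ℕ × Fin n => w a.1 * (n : ℝ≥0∞)⁻¹ := by
  refine IsSubProb.prod hw (q := fun _ : Fin n => (n : ℝ≥0∞)⁻¹) ?_
  unfold IsSubProb
  simp only [tsum_fintype, Finset.sum_const, Finset.card_univ, Fintype.card_fin, nsmul_eq_mul]
  exact ENNReal.mul_inv_le_one _

/-- The large symbols of `y` listed together with their number of occurrences. -/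
theorem exists_listing {n : ℕ} (y : Fin n → ℕ) {w : ℕ → ℝ} (hw : ∀ j, 0 < w j) (M : ℕ) :
    ∃ v : Σ k : ℕ, Fin k → ℕ × Fin n,
      (∀ j, listedWeight n v j =
        if j ∈ (Finset.univ.image y).filter (M ≤ ·) then (occ y j : ℝ) / n else 0) ∧
      ENNReal.ofReal (Real.exp (-(Real.log 2 + ∑ j ∈ (Finset.univ.image y).filter (M ≤ ·),
        (Real.log 2 + Real.log n - Real.log (w j))))) =
      ENNReal.ofReal (Real.exp (-geomLength 1 v.1)) *
        ∏ l, (ENNReal.ofReal (w (v.2 l).1) * (n : ℝ≥0∞)⁻¹) := by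
  classical
  set B := (Finset.univ.image y).filter (M ≤ ·) with hB
  have hocc : ∀ j ∈ B, 0 < occ y j ∧ occ y j ≤ n := by
    intro j hj
    obtain ⟨t, -, ht⟩ := Finset.mem_image.1 (Finset.mem_filter.1 hj).1
    exact ⟨Finset.card_pos.2 ⟨t, by simp [ht]⟩, (Finset.card_le_univ _).trans (by simp)⟩
  -- Counts lie in `1..n`, so they are stored shifted by one; `listedWeight` adds the one back.
  let g : B → ℕ × Fin n := fun b => (b, ⟨occ y b - 1, by have := hocc b b.2; omega⟩)
  refine ⟨⟨B.card, fun l => g (B.equivFin.symm l)⟩, fun j => ?_, ?_⟩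
  · rw [listedWeight]
    simp only
    rw [Equiv.sum_comp B.equivFin.symm
      (fun b : B => if (g b).1 = j then (((g b).2 : ℕ) + 1 : ℝ) / n else 0)]
    have h1 : ∀ b : B, (if (g b).1 = j then (((g b).2 : ℕ) + 1 : ℝ) / n else 0) =
        if (b : ℕ) = j then (occ y b : ℝ) / n else 0 := by
      intro b
      have : (((occ y b - 1 : ℕ) : ℝ) + 1) = occ y b := by
        rw [Nat.cast_sub (hocc b b.2).1]; simp
      simp only [g, this]
    simp only [h1]
    rw [Finset.sum_coe_sort B (fun b => if b = j then (occ y b : ℝ) / n else 0),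
      Finset.sum_ite_eq' B j]
  · simp only
    rw [Equiv.prod_comp B.equivFin.symm
      (fun b : B => ENNReal.ofReal (w (g b).1) * (n : ℝ≥0∞)⁻¹)]
    simp only [g]
    rw [Finset.prod_coe_sort B (fun b => ENNReal.ofReal (w b) * (n : ℝ≥0∞)⁻¹)]
    have h1 : ∀ b ∈ B, ENNReal.ofReal (w b) * (n : ℝ≥0∞)⁻¹ =
        ENNReal.ofReal (Real.exp (-(Real.log n - Real.log (w b)))) := by
      intro b hb
      have hn : (0 : ℝ) < n := by exact_mod_cast (hocc b hb).1.trans_le (hocc b hb).2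
      rw [neg_sub, Real.exp_sub, Real.exp_log hn, Real.exp_log (hw b), div_eq_mul_inv,
        ENNReal.ofReal_mul (hw b).le, ENNReal.ofReal_inv_of_pos hn, ENNReal.ofReal_natCast]
    rw [Finset.prod_congr rfl h1, ← ENNReal.ofReal_prod_of_nonneg (fun _ _ => (Real.exp_pos _).le),
      ← Real.exp_sum, ← ENNReal.ofReal_mul (Real.exp_pos _).le, ← Real.exp_add]
    congr 2
    simp only [add_sub_assoc, Finset.sum_add_distrib, Finset.sum_const, nsmul_eq_mul, geomLength,
      Finset.sum_neg_distrib]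
    norm_num
    ring

/-- Two-part code built from a family `ψ` of weights on the symbols below `M`, with parameters
`d` described by geometric codes, and from a list of the occurring symbols that are at least
`M`. -/
theorem exists_subProb_of_parametrization (n K M : ℕ) {s : ℕ → ℝ} (hs : ∀ j, 0 < s j)
    {ψ : (ℕ → ℕ) → ℕ → ℝ} (hψ0 : ∀ d j, 0 ≤ ψ d j) (hψM : ∀ d j, M ≤ j → ψ d j = 0)
    {w : ℕ → ℝ} (hw : ∀ j, 0 < w j) (hw1 : IsSubProb fun j => ENNReal.ofReal (w j)) :
    ∃ Q : (Fin n → ℕ) → ℝ≥0∞, IsSubProb Q ∧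
      ∀ (y : Fin n → ℕ) (θ : ℕ → ℝ) (d : ℕ → ℕ) (e : ℕ → ℝ), (∀ j, 0 ≤ θ j) →
        (∀ F : Finset ℕ, ∑ j ∈ F, θ j ≤ 1) → (∀ j, K ≤ j → d j = 0) →
        (∀ j < M, θ j ^ occ y j * Real.exp (n * ψ d j) ≤
          ψ d j ^ occ y j * Real.exp (n * θ j + e j)) →
        ENNReal.ofReal ((∏ t, θ (y t)) * Real.exp (-(∑ j ∈ Finset.range M, e j +
          ∑ j ∈ Finset.range K, geomLength (s j) (d j) + (Real.log 2 +
          ∑ j ∈ (Finset.univ.image y).filter (M ≤ ·),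
            (Real.log 2 + Real.log n - Real.log (w j)))))) ≤ Q y := by
  classical
  let ext : (Fin K → ℕ) → ℕ → ℕ := fun d j => if h : j < K then d ⟨j, h⟩ else 0
  let V := Σ k : ℕ, Fin k → ℕ × Fin n
  refine ⟨fun y => ∑' i : (Fin K → ℕ) × V,
    ((∏ j : Fin K, ENNReal.ofReal (Real.exp (-geomLength (s j) (i.1 j)))) *
      (ENNReal.ofReal (Real.exp (-geomLength 1 i.2.1)) *
        ∏ l, (ENNReal.ofReal (w (i.2.2 l).1) * (n : ℝ≥0∞)⁻¹))) *
      iidProb (fun j => ψ (ext i.1) j + listedWeight n i.2 j) y, ?_, ?_⟩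
  · refine IsSubProb.mixture (IsSubProb.prod
      (IsSubProb.pi (f := fun (j : Fin K) k => ENNReal.ofReal (Real.exp (-geomLength (s j) k)))
        fun j => isSubProb_geomLength (hs j))
      (isSubProb_tuple (isSubProb_pair hw1))) fun i => isSubProb_iidProb n _
  · intro y θ d e hθ hθ1 hd h
    set B := (Finset.univ.image y).filter (M ≤ ·) with hB
    obtain ⟨v, hv1, hv2⟩ := exists_listing y hw M
    rw [← hB] at hv1 hv2
    -- Only the mixture component with the chosen parameters and the exact listing is kept.
    refine le_trans ?_ (ENNReal.le_tsum ((fun j => d j : Fin K → ℕ), v))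
    have hext : ext (fun j => d j) = d := by
      funext j
      by_cases hj : j < K
      · simp [ext, hj]
      · simp [ext, hj, hd j (not_lt.1 hj)]
    simp only [hext]
    rw [← hv2]
    have hdis : Disjoint (Finset.range M) B := by
      rw [Finset.disjoint_left]
      intro j h1 h2
      exact absurd (Finset.mem_range.1 h1) (not_lt.2 (Finset.mem_filter.1 h2).2)
    have hBM : ∀ j, j ∈ B → M ≤ j := fun j hj => (Finset.mem_filter.1 hj).2
    have key := mul_exp_neg_le_iidProb (n := n) (y := y) (θ := θ)
      (φ := fun j => ψ d j + listedWeight n v j) (e := fun j => if j < M then e j else 0)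
      (Finset.range M ∪ B) ?_ hθ (hθ1 _) ?_ ?_ ?_
    · have hsum : ∑ j ∈ Finset.range M ∪ B, (if j < M then e j else 0) =
          ∑ j ∈ Finset.range M, e j := by
        rw [Finset.sum_union hdis, Finset.sum_congr rfl (g := e)
          (fun j hj => by simp [Finset.mem_range.1 hj]),
          Finset.sum_eq_zero (s := B) (fun j hj => by simp [hBM j hj]), add_zero]
      rw [hsum] at key
      have h1 : ∏ j : Fin K, ENNReal.ofReal (Real.exp (-geomLength (s j) (d j))) =
          ENNReal.ofReal (Real.exp (-∑ j ∈ Finset.range K, geomLength (s j) (d j))) := by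
        rw [← ENNReal.ofReal_prod_of_nonneg (fun _ _ => (Real.exp_pos _).le), ← Real.exp_sum,
          Finset.sum_neg_distrib, Fin.sum_univ_eq_sum_range (fun j => geomLength (s j) (d j))]
      rw [h1, ← ENNReal.ofReal_mul (Real.exp_pos _).le, ← Real.exp_add]
      refine le_trans (le_of_eq ?_) (mul_le_mul_right key _)
      rw [← ENNReal.ofReal_mul (Real.exp_pos _).le, mul_left_comm, ← Real.exp_add]
      congr 3
      ring
    · intro j hj
      by_cases hjM : j < M
      · exact Finset.mem_union_left _ (Finset.mem_range.2 hjM)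
      · exact Finset.mem_union_right _ (Finset.mem_filter.2 ⟨hj, not_lt.1 hjM⟩)
    · intro j
      have : 0 ≤ listedWeight n v j := by
        rw [hv1]; split_ifs <;> positivity
      exact add_nonneg (hψ0 d j) this
    · intro j hj
      rw [Finset.mem_union, not_or, Finset.mem_range, not_lt] at hj
      simp only [hψM d j hj.1, hv1, hj.2, if_false, add_zero]
    · intro j hj
      by_cases hjM : j < M
      · have : j ∉ B := fun hb => absurd hjM (not_lt.2 (hBM j hb))
        simp only [hv1, this, if_false, add_zero, hjM, if_true]
        exact h j hjM
      · have hjB : j ∈ B := by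
          rcases Finset.mem_union.1 hj with h1 | h1
          · exact absurd (Finset.mem_range.1 h1) hjM
          · exact h1
        simp only [hv1, hjB, if_true, hjM, if_false, add_zero, hψM d j (not_lt.1 hjM), zero_add]
        obtain ⟨t, -, ht⟩ := Finset.mem_image.1 (Finset.mem_filter.1 hjB).1
        have hN : 0 < occ y j := Finset.card_pos.2 ⟨t, by simp [ht]⟩
        have hNn : occ y j ≤ n := (Finset.card_le_univ _).trans (by simp)
        have hn : (0 : ℝ) < n := by exact_mod_cast hN.trans_le hNn
        have hN' : (0 : ℝ) < occ y j := by exact_mod_cast hN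
        rw [mul_div_cancel₀ _ hn.ne', show (n : ℝ) * θ j = occ y j * (n * θ j / occ y j) by
          field_simp]
        rw [show ((occ y j : ℝ)) = occ y j * 1 by ring]
        rw [Real.exp_nat_mul, mul_one, Real.exp_nat_mul, ← mul_pow, ← mul_pow]
        refine pow_le_pow_left₀ (mul_nonneg (hθ j) (Real.exp_pos _).le) ?_ _
        -- A listed symbol has the empirical weight `N / n`, which maximises `φ ^ N * exp (-n φ)`,
        -- so it incurs no loss.
        have h2 := Real.add_one_le_exp (n * θ j / occ y j - 1)
        rw [sub_add_cancel, Real.exp_sub, div_le_div_iff₀ hN' (Real.exp_pos _)] at h2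
        rw [div_mul_eq_mul_div, le_div_iff₀ hn]
        linarith

/-- Some code describes sequences at redundancy `U` relative to any monotonic law, besides the
cost of the symbols that are at least `M`. -/
def IsAchievableCost (n M : ℕ) (w : ℕ → ℝ) (U : ℝ) : Prop :=
  ∃ Q : (Fin n → ℕ) → ℝ≥0∞, IsSubProb Q ∧
    ∀ (y : Fin n → ℕ) (θ : ℕ → ℝ), (∀ j, 0 ≤ θ j) → (∀ F : Finset ℕ, ∑ j ∈ F, θ j ≤ 1) →
      Antitone θ →
      ENNReal.ofReal ((∏ t, θ (y t)) * Real.exp (-(U + (Real.log 2 +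
        ∑ j ∈ (Finset.univ.image y).filter (M ≤ ·),
          (Real.log 2 + Real.log n - Real.log (w j)))))) ≤ Q y

theorem geomLength_le {s : ℝ} (hs : 0 < s) (k : ℕ) :
    geomLength s k ≤ Real.log (1 / s) + (k + 1) * s := by
  unfold geomLength
  have := Real.log_le_sub_one_of_pos (show 0 < 1 + s by linarith)
  gcongr
  linarith

theorem isAchievableCost_of_parametrization {n K M : ℕ} {s : ℕ → ℝ} (hs : ∀ j, 0 < s j)
    {ψ : (ℕ → ℕ) → ℕ → ℝ} (hψ0 : ∀ d j, 0 ≤ ψ d j) (hψM : ∀ d j, M ≤ j → ψ d j = 0)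
    {w : ℕ → ℝ} (hw : ∀ j, 0 < w j) (hw1 : IsSubProb fun j => ENNReal.ofReal (w j)) {U : ℝ}
    (h : ∀ (y : Fin n → ℕ) (θ : ℕ → ℝ), (∀ j, 0 ≤ θ j) → (∀ F : Finset ℕ, ∑ j ∈ F, θ j ≤ 1) →
      Antitone θ → ∃ (d : ℕ → ℕ) (e : ℕ → ℝ), (∀ j, K ≤ j → d j = 0) ∧
        (∀ j < M, θ j ^ occ y j * Real.exp (n * ψ d j) ≤
          ψ d j ^ occ y j * Real.exp (n * θ j + e j)) ∧
        ∑ j ∈ Finset.range M, e j + ∑ j ∈ Finset.range K, geomLength (s j) (d j) ≤ U) :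
    IsAchievableCost n M w U := by
  obtain ⟨Q, hQ, hQ'⟩ := exists_subProb_of_parametrization n K M hs hψ0 hψM hw hw1
  refine ⟨Q, hQ, fun y θ hθ hθ1 hanti => ?_⟩
  obtain ⟨d, e, hd, he, hU⟩ := h y θ hθ hθ1 hanti
  refine le_trans (ENNReal.ofReal_le_ofReal ?_) (hQ' y θ d e hθ hθ1 hd he)
  have : 0 ≤ ∏ t, θ (y t) := Finset.prod_nonneg fun _ _ => hθ _
  gcongr

/-! ### Small alphabets: rounding square roots of counts. -/

/-- With `a = √N`, the loss is at most `(k - a) ^ 2 * (2 a / k + 1)`, and `0 ≤ k - a < 1` bounds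
this by 3. On the square-root scale a unit error costs `O(1)` whatever the size of `N`. -/
theorem pow_mul_exp_le_of_sqrt_rounding {n N k : ℕ} {θ : ℝ} (hn : 0 < n) (hθ : 0 ≤ θ)
    (hk : k = ⌈√(N : ℝ)⌉₊) :
    θ ^ N * Real.exp (n * ((k : ℝ) ^ 2 / n)) ≤
      ((k : ℝ) ^ 2 / n) ^ N * Real.exp (n * θ + 3) := by
  have hn' : (0 : ℝ) < n := by exact_mod_cast hn
  rw [mul_div_cancel₀ _ hn'.ne']
  rcases Nat.eq_zero_or_pos N with rfl | hN
  · simp only [Nat.cast_zero, Real.sqrt_zero, Nat.ceil_zero] at hk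
    subst hk
    simp
    positivity
  set a := √(N : ℝ) with ha
  have hN' : (0 : ℝ) < N := by exact_mod_cast hN
  have ha0 : 0 < a := Real.sqrt_pos.2 hN'
  have ha2 : a ^ 2 = N := Real.sq_sqrt hN'.le
  have hak : a ≤ k := hk ▸ Nat.le_ceil a
  have hka : (k : ℝ) < a + 1 := hk ▸ Nat.ceil_lt_add_one ha0.le
  have hk0 : (0 : ℝ) < k := ha0.trans_le hak
  have h1 : (n * θ / N) ≤ Real.exp (n * θ / N - 1) := by
    linarith [Real.add_one_le_exp (n * θ / N - 1)]
  have h2 : a / k ≤ Real.exp (a / k - 1) := by linarith [Real.add_one_le_exp (a / k - 1)]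
  have h3 : θ = (k : ℝ) ^ 2 / n * ((n * θ / N) * (a / k) ^ 2) := by
    field_simp; rw [ha2]
  have h4 : θ ≤ (k : ℝ) ^ 2 / n * (Real.exp (n * θ / N - 1) * Real.exp (a / k - 1) ^ 2) := by
    calc θ = (k : ℝ) ^ 2 / n * ((n * θ / N) * (a / k) ^ 2) := h3
      _ ≤ _ := by gcongr
  calc θ ^ N * Real.exp ((k : ℝ) ^ 2)
      ≤ ((k : ℝ) ^ 2 / n * (Real.exp (n * θ / N - 1) * Real.exp (a / k - 1) ^ 2)) ^ N *
        Real.exp ((k : ℝ) ^ 2) := by gcongr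
    _ = ((k : ℝ) ^ 2 / n) ^ N *
        Real.exp (n * θ - N + 2 * (N * (a / k - 1)) + (k : ℝ) ^ 2) := by
      rw [mul_pow, mul_pow, ← Real.exp_nat_mul, ← Real.exp_nat_mul, ← Real.exp_nat_mul, mul_assoc,
        ← Real.exp_add, ← Real.exp_add]
      congr 2
      push_cast
      field_simp
    _ ≤ _ := by
      gcongr ?_ * Real.exp ?_
      have h5 : (2 * (N * (a / k - 1)) + (k : ℝ) ^ 2 - N) = (k - a) ^ 2 * (2 * (a / k) + 1) := by
        rw [← ha2]; field_simp; ring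
      have h6 : (k - a) ^ 2 * (2 * (a / k) + 1) ≤ 1 ^ 2 * (2 * 1 + 1) := by
        have : a / k ≤ 1 := (div_le_one hk0).2 hak
        have h7 : 0 ≤ (k : ℝ) - a := by linarith
        gcongr
        linarith
      linarith

/-- The counts average at most `n / M`, so `√(M / n)` is the natural scale for `√N`: its logarithm
yields half of `log (n / M)`, and AM-GM keeps the linear terms `O(M)` in total. -/
theorem isAchievableCost_smallAlphabet {n M : ℕ} (hM : 1 ≤ M) (hMn : M ≤ n) {w : ℕ → ℝ}
    (hw : ∀ j, 0 < w j) (hw1 : IsSubProb fun j => ENNReal.ofReal (w j)) :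
    IsAchievableCost n M w (M * (Real.log (n / M) / 2) + 6 * M) := by
  have hM0 : (0 : ℝ) < M := by exact_mod_cast hM
  have hn : 0 < n := by omega
  have hn0 : (0 : ℝ) < n := by exact_mod_cast hn
  have hMn' : (M : ℝ) ≤ n := by exact_mod_cast hMn
  set s := √((M : ℝ) / n) with hs
  have hs0 : 0 < s := Real.sqrt_pos.2 (by positivity)
  have hs2 : s ^ 2 = M / n := Real.sq_sqrt (by positivity)
  have hs1 : s ≤ 1 := by rw [hs, Real.sqrt_le_one]; exact (div_le_one hn0).2 hMn'
  refine isAchievableCost_of_parametrization (K := M) (s := fun _ => s)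
    (ψ := fun d j => if j < M then (d j : ℝ) ^ 2 / n else 0) (fun _ => hs0)
    (fun d j => by split_ifs <;> positivity) (fun d j hj => by simp [hj]) hw hw1 ?_
  intro y θ hθ hθ1 _
  refine ⟨fun j => if j < M then ⌈√(occ y j : ℝ)⌉₊ else 0, fun _ => 3,
    fun j hj => by simp [hj], fun j hj => ?_, ?_⟩
  · simp only [hj, if_true]
    exact pow_mul_exp_le_of_sqrt_rounding hn (hθ j) rfl
  · have h1 : ∀ j ∈ Finset.range M, geomLength s (if j < M then ⌈√(occ y j : ℝ)⌉₊ else 0) ≤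
        Real.log (n / M) / 2 + 2 + (occ y j * (M / n) + 1) / 2 := by
      intro j hj
      rw [if_pos (Finset.mem_range.1 hj)]
      refine (geomLength_le hs0 _).trans ?_
      have h2 : Real.log (1 / s) = Real.log (n / M) / 2 := by
        rw [one_div, Real.log_inv, hs, Real.log_sqrt (by positivity),
          ← inv_div (M : ℝ) n, Real.log_inv]
        ring
      have h3 := (Nat.ceil_lt_add_one (Real.sqrt_nonneg (occ y j : ℝ))).le
      have h4 : √(occ y j : ℝ) ^ 2 = occ y j := Real.sq_sqrt (Nat.cast_nonneg _)
      have h5 : √(occ y j : ℝ) * s ≤ (occ y j * (M / n) + 1) / 2 := by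
        have h6 : (occ y j : ℝ) * (M / n) = (√(occ y j : ℝ) * s) ^ 2 := by rw [mul_pow, h4, hs2]
        rw [h6]
        linarith [sq_nonneg (√(occ y j : ℝ) * s - 1)]
      rw [h2]
      have h6 : ((⌈√(occ y j : ℝ)⌉₊ : ℝ) + 1) * s ≤ (√(occ y j : ℝ) + 1 + 1) * s := by gcongr
      linarith
    have h7 := Finset.sum_le_sum h1
    have h8 : (∑ j ∈ Finset.range M, (occ y j : ℝ)) ≤ n := by
      exact_mod_cast sum_occ_le y (Finset.range M)
    have h9 : (∑ j ∈ Finset.range M, (occ y j : ℝ)) * (M / n) ≤ M := by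
      calc _ ≤ (n : ℝ) * (M / n) := by gcongr
        _ = M := by field_simp
    simp only [Finset.sum_add_distrib, ← Finset.sum_div, ← Finset.sum_mul, Finset.sum_const,
      Finset.card_range, nsmul_eq_mul] at h7 ⊢
    linarith

/-! ### Medium alphabets: coding differences of monotone weights. -/

theorem sum_Ico_sub_succ {k : ℕ → ℕ} (hk : Antitone k) {K : ℕ} (hK : k K = 0) {i : ℕ} (hi : i ≤ K) :
    ∑ j ∈ Finset.Ico i K, (k j - k (j + 1)) = k i := by
  have : ∀ m, i ≤ m → ∑ j ∈ Finset.Ico i m, (k j - k (j + 1)) = k i - k m := by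
    intro m hm
    induction m, hm using Nat.le_induction with
    | base => simp
    | succ m hm ih =>
      rw [Finset.sum_Ico_succ_top hm, ih]
      have h1 := hk hm
      have h2 := hk (Nat.le_succ m)
      simp only [Nat.succ_eq_add_one] at h2
      omega
  simpa [hK] using this K hi

theorem sum_range_mul_sub_succ {k : ℕ → ℕ} (hk : Antitone k) {K : ℕ} (hK : k K = 0) :
    ∑ j ∈ Finset.range K, ((j : ℝ) + 1) * ((k j - k (j + 1) : ℕ) : ℝ) =
      ∑ j ∈ Finset.range K, (k j : ℝ) := by
  have : ∀ m : ℕ, ∑ j ∈ Finset.range m, ((j : ℝ) + 1) * ((k j - k (j + 1) : ℕ) : ℝ) =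
      ∑ j ∈ Finset.range m, (k j : ℝ) - m * k m := by
    intro m
    induction m with
    | zero => simp
    | succ m ih =>
      rw [Finset.sum_range_succ, Finset.sum_range_succ, ih, Nat.cast_sub (hk (Nat.le_succ m))]
      push_cast
      ring
  simpa [hK] using this K

theorem pow_mul_exp_le_of_le {n N : ℕ} {θ ψ : ℝ} (hθ : 0 ≤ θ) (h : θ ≤ ψ) :
    θ ^ N * Real.exp (n * ψ) ≤ ψ ^ N * Real.exp (n * θ + n * (ψ - θ)) := by
  rw [show (n : ℝ) * θ + n * (ψ - θ) = n * ψ by ring]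
  gcongr

/-- Since the differences weighted by `j + 1` sum to `∑ k j ≤ n + M`, the `j`-th one gets mean `n /
((j + 1) M)`. The logarithms of the scales then add up to `M log (n / M) - log M!`. -/
theorem isAchievableCost_mediumAlphabet {n M : ℕ} (hM : 1 ≤ M) (hMn : M ^ 2 ≤ n) {w : ℕ → ℝ}
    (hw : ∀ j, 0 < w j) (hw1 : IsSubProb fun j => ENNReal.ofReal (w j)) :
    IsAchievableCost n M w (M * Real.log (n / M ^ 2) + 5 * M) := by
  have hM0 : (0 : ℝ) < M := by exact_mod_cast hM
  have hn : 0 < n := by nlinarith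
  have hn0 : (0 : ℝ) < n := by exact_mod_cast hn
  have hMn' : (M : ℝ) ^ 2 ≤ n := by exact_mod_cast hMn
  refine isAchievableCost_of_parametrization (K := M) (s := fun j => ((j : ℝ) + 1) * (M / n))
    (ψ := fun d j => (∑ i ∈ Finset.Ico j M, d i : ℕ) / (n : ℝ)) (fun _ => by positivity)
    (fun d j => by positivity) (fun d j hj => by simp [hj]) hw hw1 ?_
  intro y θ hθ hθ1 hanti
  -- The cut to zero at `M` makes the last difference carry `k (M - 1)`, so tail sums recover every
  -- `k j`.
  set k : ℕ → ℕ := fun j => if j < M then ⌈n * θ j⌉₊ else 0 with hk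
  have hkM : k M = 0 := by simp [hk]
  have hkanti : Antitone k := by
    intro a b hab
    simp only [hk]
    by_cases hb : b < M
    · rw [if_pos hb, if_pos (hab.trans_lt hb)]
      exact Nat.ceil_mono (mul_le_mul_of_nonneg_left (hanti hab) hn0.le)
    · simp [hb]
  have hkj : ∀ j < M, (k j : ℝ) = ⌈n * θ j⌉₊ := fun j hj => by simp [hk, hj]
  have hψ : ∀ j < M, ((∑ i ∈ Finset.Ico j M, (k i - k (i + 1)) : ℕ) / (n : ℝ)) = k j / n :=
    fun j hj => by rw [sum_Ico_sub_succ hkanti hkM hj.le]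
  have hksum : ∑ j ∈ Finset.range M, (k j : ℝ) ≤ ∑ j ∈ Finset.range M, (n * θ j + 1) := by
    refine Finset.sum_le_sum fun j hj => ?_
    rw [hkj j (Finset.mem_range.1 hj)]
    exact (Nat.ceil_lt_add_one (mul_nonneg hn0.le (hθ j))).le
  have hθM := hθ1 (Finset.range M)
  refine ⟨fun j => k j - k (j + 1), fun j => n * (k j / n - θ j), fun j hj => ?_, fun j hj => ?_, ?_⟩
  · have h1 : ¬ j < M := not_lt.2 hj
    simp [hk, h1]
  · simp only
    rw [hψ j hj]
    refine pow_mul_exp_le_of_le (hθ j) ?_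
    rw [le_div_iff₀ hn0, hkj j hj]
    exact (mul_comm _ _).trans_le (Nat.le_ceil _)
  · have h1 : ∑ j ∈ Finset.range M, (n : ℝ) * (k j / n - θ j) ≤ M := by
      have : ∀ j ∈ Finset.range M, (n : ℝ) * (k j / n - θ j) = k j - n * θ j := by
        intro j _; field_simp
      rw [Finset.sum_congr rfl this, Finset.sum_sub_distrib]
      rw [Finset.sum_add_distrib] at hksum
      simp at hksum
      linarith
    have h2 : ∑ j ∈ Finset.range M, geomLength (((j : ℝ) + 1) * (M / n)) (k j - k (j + 1)) ≤
        ∑ j ∈ Finset.range M, (Real.log (n / M) - Real.log (j + 1) +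
          (((j : ℝ) + 1) * ((k j - k (j + 1) : ℕ) : ℝ)) * (M / n) + M * (M / n)) := by
      refine Finset.sum_le_sum fun j hj => ?_
      refine (geomLength_le (by positivity) _).trans ?_
      have h3 : Real.log (1 / (((j : ℝ) + 1) * (M / n))) = Real.log (n / M) - Real.log (j + 1) := by
        rw [← Real.log_div (by positivity) (by positivity)]
        congr 1
        field_simp
      have h4 : ((j : ℝ) + 1) ≤ M := by exact_mod_cast Finset.mem_range.1 hj
      have h5 : ((j : ℝ) + 1) * (M / n) ≤ M * (M / n) := by gcongr
      rw [h3]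
      linarith
    have h6 : ∑ j ∈ Finset.range M, Real.log ((j : ℝ) + 1) = Real.log (M.factorial) := by
      rw [← Finset.prod_range_add_one_eq_factorial]
      push_cast
      rw [Real.log_prod (fun j _ => by positivity)]
    -- The lower Stirling bound, from `M ^ M / M! ≤ exp M`.
    have h7 : M * Real.log M - M ≤ Real.log (M.factorial) := by
      have h8 := Real.pow_div_factorial_le_exp (M : ℝ) hM0.le M
      have h9 := Real.log_le_log (by positivity) h8
      rw [Real.log_exp, Real.log_div (by positivity) (by positivity), Real.log_pow] at h9
      linarith
    have h10 : Real.log (n / M) = Real.log (n / M ^ 2) + Real.log M := by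
      rw [← Real.log_mul (by positivity) (by positivity)]
      congr 1
      field_simp
    have h11 : M * (M / n : ℝ) ≤ 1 := by
      rw [← mul_div_assoc, div_le_one hn0]; nlinarith
    have h12 : (∑ j ∈ Finset.range M, (k j : ℝ)) * (M / n) ≤ 2 * M := by
      calc (∑ j ∈ Finset.range M, (k j : ℝ)) * (M / n) ≤ (n + M) * (M / n) := by
            gcongr
            rw [Finset.sum_add_distrib, ← Finset.mul_sum] at hksum
            simp at hksum
            nlinarith
        _ = M + M * (M * (M / n)) / 1 / M * M / M := by field_simp
        _ ≤ 2 * M := by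
          have : M * (M * (M / n : ℝ)) / 1 / M * M / M = M * (M / n : ℝ) := by field_simp
          rw [this]
          have : (1 : ℝ) ≤ M := by exact_mod_cast hM
          linarith
    simp only [Finset.sum_add_distrib, Finset.sum_sub_distrib, ← Finset.sum_mul,
      sum_range_mul_sub_succ hkanti hkM, Finset.sum_const, Finset.card_range, nsmul_eq_mul, h6] at h2
    rw [h10] at h2
    have h13 : (M : ℝ) * (M * (M / n)) ≤ M * 1 := by gcongr
    have h14 : (∑ j ∈ Finset.range M, geomLength (((j : ℝ) + 1) * (M / n)) (k j - k (j + 1))) ≤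
      M * Real.log (n / M ^ 2) + 4 * M := by linarith
    linarith

/-! ### Large alphabets: rounding level sets. -/

/-- A discrete layer-cake formula: increments starting below `a` reach at least `a`, by induction on
`min a (t m)`. -/
theorem sub_le_sum_ite_lt {t : ℕ → ℝ} (ht : Monotone t) {a : ℝ} (G : ℕ) (ha : a ≤ t G) :
    a ≤ t 0 + ∑ g ∈ Finset.range G, if t g < a then t (g + 1) - t g else 0 := by
  have key : ∀ m, min a (t m) ≤
      t 0 + ∑ g ∈ Finset.range m, if t g < a then t (g + 1) - t g else 0 := by
    intro m
    induction m with
    | zero => simp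
    | succ m ih =>
      rw [Finset.sum_range_succ]
      have h1 := ht (Nat.le_succ m)
      simp only [Nat.succ_eq_add_one] at h1
      split_ifs with h
      · rw [min_eq_right h.le] at ih
        exact (min_le_right _ _).trans (by linarith)
      · rw [min_eq_left (not_lt.1 h)] at ih
        exact (min_le_left _ _).trans (by linarith)
  simpa [min_eq_left ha] using key G

/-- The last increment used starts below `a` and multiplies by `r`, so rounding up overshoots by at
most the factor `r`. -/
theorem sum_ite_lt_le {τ r a : ℝ} (hτ : 0 ≤ τ) (hr : 1 ≤ r) (ha : 0 ≤ a) (G : ℕ) :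
    (∑ g ∈ Finset.range G, if τ * r ^ g < a then τ * r ^ (g + 1) - τ * r ^ g else 0) ≤ r * a := by
  induction G with
  | zero => simp; positivity
  | succ G ih =>
    rw [Finset.sum_range_succ]
    split_ifs with h
    · have h1 : (∑ g ∈ Finset.range G, if τ * r ^ g < a then τ * r ^ (g + 1) - τ * r ^ g else 0) ≤
          ∑ g ∈ Finset.range G, (τ * r ^ (g + 1) - τ * r ^ g) := by
        refine Finset.sum_le_sum fun g _ => ?_
        split_ifs
        · exact le_rfl
        · have := pow_le_pow_right₀ hr (Nat.le_succ g)
          simp only [Nat.succ_eq_add_one] at this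
          nlinarith
      rw [Finset.sum_range_sub (fun g => τ * r ^ g) G] at h1
      simp only [pow_zero, mul_one] at h1
      have h2 : τ * r ^ (G + 1) ≤ r * a := by
        rw [pow_succ']
        nlinarith
      linarith
    · linarith

/-- The grid `0, ⌊r ^ 0⌋, ⌊r ^ 1⌋, …` used to round level-set sizes. -/
noncomputable def levelGrid (r : ℝ) : ℕ → ℕ
  | 0 => 0
  | h + 1 => ⌊r ^ h⌋₊

theorem exists_le_levelGrid {r : ℝ} (hr : 1 < r) (N : ℕ) : ∃ h, N ≤ levelGrid r h := by
  obtain ⟨h, hh⟩ := pow_unbounded_of_one_lt (N : ℝ) hr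
  exact ⟨h + 1, Nat.le_floor hh.le⟩

-- `f N` is the least grid index reaching `N`. By minimality the preceding power of `r` is below
-- `N`, so one more factor `r` suffices despite the floors; 0 and 1 are on the grid exactly.
open Classical in
theorem exists_levelGrid_rounding {r : ℝ} (hr : 1 < r) :
    ∃ f : ℕ → ℕ, Monotone f ∧ (∀ N, N ≤ levelGrid r (f N)) ∧
      (∀ N, (levelGrid r (f N) : ℝ) ≤ r * N) ∧ ∀ N h : ℕ, (N : ℝ) ≤ r ^ h → f N ≤ h + 1 := by
  refine ⟨fun N => Nat.find (exists_le_levelGrid hr N), ?_,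
    fun N => Nat.find_spec (exists_le_levelGrid hr N), fun N => ?_, fun N h hN => ?_⟩
  · intro a b hab
    exact Nat.find_min' _ (hab.trans (Nat.find_spec (exists_le_levelGrid hr b)))
  · have hmin := fun m => Nat.find_min (exists_le_levelGrid hr N) (m := m)
    dsimp only
    generalize Nat.find (exists_le_levelGrid hr N) = h at hmin
    match h with
    | 0 => simp [levelGrid]; positivity
    | 1 =>
      have h1 : 0 < N := by have := hmin 0 (by norm_num); simp [levelGrid] at this; omega
      have h2 : (1 : ℝ) ≤ N := by exact_mod_cast h1
      simp [levelGrid]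
      nlinarith
    | h + 2 =>
      have h1 := hmin (h + 1) (by omega)
      simp only [levelGrid, not_le] at h1 ⊢
      have h2 : r ^ h < N := (Nat.floor_lt (by positivity)).1 h1
      calc (⌊r ^ (h + 1)⌋₊ : ℝ) ≤ r ^ (h + 1) := Nat.floor_le (by positivity)
        _ = r * r ^ h := pow_succ' _ _
        _ ≤ r * N := by gcongr
  · exact Nat.find_min' _ (Nat.le_floor hN)

theorem two_pow_le_one_add_inv_pow {D : ℕ} (hD : 1 ≤ D) (k : ℕ) :
    (2 : ℝ) ^ k ≤ (1 + 1 / (D : ℝ)) ^ (D * k) := by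
  have hD0 : (0 : ℝ) < D := by exact_mod_cast hD
  rw [pow_mul]
  gcongr
  have h1 : (0 : ℝ) ≤ 1 / D := by positivity
  have := one_add_mul_le_pow (a := 1 / (D : ℝ)) (by linarith) D
  have h2 : (D : ℝ) * (1 / D) = 1 := by field_simp
  linarith

/-- Level sets of an antitone function are initial segments, hence determined by their size. -/
theorem exists_levelSet_card {θ : ℕ → ℝ} (hθ : Antitone θ) (M : ℕ) :
    ∃ N : ℝ → ℕ, Antitone N ∧ (∀ a, N a ≤ M) ∧ ∀ a, ∀ j < M, a < θ j ↔ j < N a := by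
  classical
  refine ⟨fun a => ((Finset.range M).filter fun j => a < θ j).card, fun a b hab => ?_, fun a => ?_,
    fun a j hj => ⟨fun h => ?_, fun h => ?_⟩⟩
  · exact Finset.card_le_card (Finset.monotone_filter_right _ fun j _ h => hab.trans_lt h)
  · exact (Finset.card_filter_le _ _).trans (by simp)
  · have : Finset.range (j + 1) ⊆ (Finset.range M).filter fun j => a < θ j := by
      intro i hi
      have hi' := Finset.mem_range_succ_iff.1 hi
      exact Finset.mem_filter.2 ⟨Finset.mem_range.2 (hi'.trans_lt hj), h.trans_le (hθ hi')⟩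
    have := Finset.card_le_card this
    rw [Finset.card_range] at this
    exact this
  · by_contra hc
    have : ((Finset.range M).filter fun j => a < θ j) ⊆ Finset.range j := by
      intro i hi
      rw [Finset.mem_range]
      by_contra hij
      exact hc ((Finset.mem_filter.1 hi).2.trans_le (hθ (not_lt.1 hij)))
    have := Finset.card_le_card this
    rw [Finset.card_range] at this
    exact absurd h (not_lt.2 this)

theorem isAchievableCost_largeAlphabet {n M D : ℕ} (hM : 1 ≤ M) (hD : 1 ≤ D) {w : ℕ → ℝ}
    (hw : ∀ j, 0 < w j) (hw1 : IsSubProb fun j => ENNReal.ofReal (w j)) :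
    IsAchievableCost n M w ((2 * (D * Nat.clog 2 (M * D)) + 1) * Real.log 2 + 4 * n / D) := by
  have hM0 : (0 : ℝ) < M := by exact_mod_cast hM
  have hD0 : (0 : ℝ) < D := by exact_mod_cast hD
  have hn0 : (0 : ℝ) ≤ n := Nat.cast_nonneg n
  set c := Nat.clog 2 (M * D) with hc
  -- Bernoulli gives `r ^ D ≥ 2`, so `G` thresholds climb from `1 / (M * D)` past 1, above every `θ
  -- j`.
  set G := D * c with hG
  set r : ℝ := 1 + 1 / (D : ℝ) with hr
  have hδ : (1 : ℝ) / D ≤ 1 := (div_le_one hD0).2 (by exact_mod_cast hD)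
  have hδ0 : (0 : ℝ) < 1 / D := by positivity
  have hr1 : 1 < r := by linarith
  set τ : ℝ := 1 / (M * D) with hτ
  have hτ0 : 0 < τ := by positivity
  set t : ℕ → ℝ := fun g => τ * r ^ g with ht
  have htmono : Monotone t := fun a b hab => by
    simp only [ht]; gcongr; exact hr1.le
  have hMDG : ((M * D : ℕ) : ℝ) ≤ r ^ G := by
    have h1 : M * D ≤ 2 ^ c := Nat.le_pow_clog (by norm_num) _
    have h2 : ((M * D : ℕ) : ℝ) ≤ 2 ^ c := by exact_mod_cast h1
    exact h2.trans (two_pow_le_one_add_inv_pow hD c)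
  have htG : 1 ≤ t G := by
    simp only [ht, hτ]
    rw [one_div_mul_eq_div, one_le_div (by positivity)]
    exact_mod_cast hMDG
  obtain ⟨f, hf, hf1, hf2, hf3⟩ := exists_levelGrid_rounding hr1
  refine isAchievableCost_of_parametrization (K := G) (s := fun _ => 1)
    (ψ := fun d j => if j < M then τ + ∑ g ∈ Finset.range G,
      if j < levelGrid r (∑ i ∈ Finset.Ico g G, d i) then t (g + 1) - t g else 0 else 0)
    (fun _ => one_pos) (fun d j => ?_) (fun d j hj => by simp [hj]) hw hw1 ?_
  · split_ifs
    · refine add_nonneg hτ0.le (Finset.sum_nonneg fun g _ => ?_)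
      split_ifs
      · exact sub_nonneg.2 (htmono (Nat.le_succ g))
      · exact le_rfl
    · exact le_rfl
  intro y θ hθ hθ1 hanti
  obtain ⟨N, hN, hNM, hNθ⟩ := exists_levelSet_card hanti M
  set k : ℕ → ℕ := fun g => if g < G then f (N (t g)) else 0 with hk
  have hkG : k G = 0 := by simp [hk]
  have hkanti : Antitone k := by
    intro a b hab
    simp only [hk]
    by_cases hb : b < G
    · rw [if_pos hb, if_pos (hab.trans_lt hb)]
      exact hf (hN (htmono hab))
    · simp [hb]
  set ψ : ℕ → ℝ := fun j => τ + ∑ g ∈ Finset.range G,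
      if j < levelGrid r (k g) then t (g + 1) - t g else 0 with hψ
  have hkg : ∀ g ∈ Finset.range G, k g = f (N (t g)) := fun g hg => by
    simp [hk, Finset.mem_range.1 hg]
  have hθle : ∀ j < M, θ j ≤ ψ j := by
    intro j hj
    have h1 : θ j ≤ t G := by
      have := hθ1 {j}
      rw [Finset.sum_singleton] at this
      exact this.trans htG
    refine (sub_le_sum_ite_lt htmono G h1).trans ?_
    simp only [hψ]
    have h2 : t 0 = τ := by simp [ht]
    rw [h2]
    gcongr with g hg
    have h3 := htmono (Nat.le_succ g)
    simp only [Nat.succ_eq_add_one] at h3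
    by_cases h4 : t g < θ j
    · have h5 : j < levelGrid r (k g) := by
        rw [hkg g hg]
        exact ((hNθ (t g) j hj).1 h4).trans_le (hf1 _)
      rw [if_pos h4, if_pos h5]
    · rw [if_neg h4]
      split_ifs <;> linarith
  -- The floor `τ` contributes `1 / D`; one factor `r` comes from rounding set sizes, the other from
  -- rounding values. As `r ^ 2 - 1 ≤ 3 / D`, the loss is at most `4 n / D`.
  have hψsum : ∑ j ∈ Finset.range M, ψ j ≤ 1 / D + r * (r * ∑ j ∈ Finset.range M, θ j) := by
    simp only [hψ]
    rw [Finset.sum_add_distrib, Finset.sum_const, Finset.card_range, nsmul_eq_mul]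
    have h1 : (M : ℝ) * τ = 1 / D := by rw [hτ]; field_simp
    rw [h1, Finset.sum_comm]
    gcongr
    have h2 : ∀ g ∈ Finset.range G,
        (∑ j ∈ Finset.range M, if j < levelGrid r (k g) then t (g + 1) - t g else 0) ≤
        r * ∑ j ∈ Finset.range M, if t g < θ j then t (g + 1) - t g else 0 := by
      intro g hg
      have h3 := htmono (Nat.le_succ g)
      simp only [Nat.succ_eq_add_one] at h3
      have h5 : ∀ m : ℕ, (∑ j ∈ Finset.range M, if j < m then t (g + 1) - t g else 0) =
          ((min m M : ℕ) : ℝ) * (t (g + 1) - t g) := by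
        intro m
        rw [← Finset.sum_filter, Finset.sum_const, nsmul_eq_mul]
        congr 2
        rw [show (Finset.range M).filter (· < m) = Finset.range (min m M) by
          ext i; simp [and_comm], Finset.card_range]
      have h6 : (∑ j ∈ Finset.range M, if t g < θ j then t (g + 1) - t g else 0) =
          ∑ j ∈ Finset.range M, if j < N (t g) then t (g + 1) - t g else 0 :=
        Finset.sum_congr rfl fun j hj => by simp only [hNθ (t g) j (Finset.mem_range.1 hj)]
      rw [h6, h5, h5, min_eq_left (hNM _), ← mul_assoc]
      refine mul_le_mul_of_nonneg_right ?_ (sub_nonneg.2 h3)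
      have h7 : ((min (levelGrid r (k g)) M : ℕ) : ℝ) ≤ levelGrid r (k g) := by
        exact_mod_cast min_le_left _ _
      rw [hkg g hg] at h7 ⊢
      exact h7.trans (hf2 _)
    refine (Finset.sum_le_sum h2).trans ?_
    rw [← Finset.mul_sum, Finset.sum_comm]
    gcongr
    rw [Finset.mul_sum]
    exact Finset.sum_le_sum fun j _ => sum_ite_lt_le hτ0.le hr1.le (hθ j) G
  refine ⟨fun g => k g - k (g + 1), fun j => n * (ψ j - θ j), fun g hg => ?_, fun j hj => ?_, ?_⟩
  · have h1 : ¬ g < G := not_lt.2 hg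
    simp [hk, h1]
  · have h1 : ∀ g ∈ Finset.range G, ∑ i ∈ Finset.Ico g G, (k i - k (i + 1)) = k g :=
      fun g hg => sum_Ico_sub_succ hkanti hkG (Finset.mem_range.1 hg).le
    have h2 : (τ + ∑ g ∈ Finset.range G,
        if j < levelGrid r (∑ i ∈ Finset.Ico g G, (k i - k (i + 1))) then t (g + 1) - t g else 0)
        = ψ j := by
      simp only [hψ]
      congr 1
      exact Finset.sum_congr rfl fun g hg => by rw [h1 g hg]
    simp only [hj, if_true]
    rw [h2]
    exact pow_mul_exp_le_of_le (hθ j) (hθle j hj)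
  · have h1 : ∑ j ∈ Finset.range M, (n : ℝ) * (ψ j - θ j) ≤ 4 * n / D := by
      rw [← Finset.mul_sum, Finset.sum_sub_distrib]
      have h2 := hθ1 (Finset.range M)
      have h3 : ∑ j ∈ Finset.range M, ψ j - ∑ j ∈ Finset.range M, θ j ≤ 4 * (1 / D) := by
        have h4 : r * (r * ∑ j ∈ Finset.range M, θ j) - ∑ j ∈ Finset.range M, θ j =
            (r * r - 1) * ∑ j ∈ Finset.range M, θ j := by ring
        have h5 : (r * r - 1) = 2 * (1 / D) + (1 / D) * (1 / D) := by rw [hr]; ring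
        have h6 : (r * r - 1) * ∑ j ∈ Finset.range M, θ j ≤ (r * r - 1) * 1 := by
          gcongr
          nlinarith
        nlinarith
      calc (n : ℝ) * (∑ j ∈ Finset.range M, ψ j - ∑ j ∈ Finset.range M, θ j)
          ≤ n * (4 * (1 / D)) := by gcongr
        _ = 4 * n / D := by ring
    -- At scale 1 a step `k` costs `k + 1` bits, so the staircase costs `k 0 + G` bits; `k 0 ≤ G +
    -- 1` because level sets have at most `M ≤ r ^ G` elements.
    have h2 : ∑ g ∈ Finset.range G, geomLength 1 (k g - k (g + 1)) =
        (k 0 + G) * Real.log 2 := by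
      have h3 : ∀ g : ℕ, geomLength 1 (k g - k (g + 1)) =
          (((k g - k (g + 1) : ℕ) : ℝ) + 1) * Real.log 2 := by
        intro g; simp [geomLength]; norm_num
      simp only [h3]
      rw [← Finset.sum_mul, Finset.sum_add_distrib, ← Nat.cast_sum, Finset.range_eq_Ico,
        sum_Ico_sub_succ hkanti hkG (Nat.zero_le _)]
      simp
    have h4 : k 0 ≤ G + 1 := by
      simp only [hk]
      split_ifs
      · refine hf3 _ _ (le_trans ?_ hMDG)
        exact_mod_cast (hNM _).trans (Nat.le_mul_of_pos_right _ hD)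
      · omega
    have h5 : (k 0 : ℝ) ≤ G + 1 := by exact_mod_cast h4
    have h6 : (G : ℝ) = D * c := by rw [hG]; push_cast; ring
    have h7 : ((k 0 : ℝ) + G) * Real.log 2 ≤ (2 * (D * c) + 1) * Real.log 2 := by
      have := Real.log_nonneg (show (1 : ℝ) ≤ 2 by norm_num)
      exact mul_le_mul_of_nonneg_right (by linarith) this
    rw [h2]
    linarith

/-! ### From sub-probabilities to one universal code. -/

/-- Averaging `Q` with a strictly positive law keeps every length finite, at the price of one bit.
-/
theorem exists_codeLength_of_isSubProb {n : ℕ} {Q : (Fin n → ℕ+) → ℝ≥0∞} (hQ : IsSubProb Q) :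
    ∃ L : (Fin n → ℕ+) → ℝ, IsCodeLength L ∧
      ∀ x a, ENNReal.ofReal (Real.exp (-a)) ≤ Q x → L x * Real.log 2 ≤ a + Real.log 2 := by
  obtain ⟨q, hq0, hq⟩ := ENNReal.exists_pos_sum_of_countable' (one_ne_zero : (1 : ℝ≥0∞) ≠ 0)
    (Fin n → ℕ+)
  set R : (Fin n → ℕ+) → ℝ≥0∞ := fun x => 2⁻¹ * Q x + 2⁻¹ * q x with hR
  have hR1 : ∑' x, R x ≤ 1 := by
    simp only [hR]
    rw [ENNReal.tsum_add, ENNReal.tsum_mul_left, ENNReal.tsum_mul_left]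
    calc 2⁻¹ * ∑' x, Q x + 2⁻¹ * ∑' x, q x ≤ 2⁻¹ * 1 + 2⁻¹ * 1 := by
          gcongr
          exact hQ
      _ = 1 := by rw [mul_one, ENNReal.inv_two_add_inv_two]
  have hRtop : ∀ x, R x ≠ ⊤ := fun x =>
    ((ENNReal.le_tsum x).trans hR1).trans_lt ENNReal.one_lt_top |>.ne
  have hRpos : ∀ x, 0 < (R x).toReal := fun x => by
    refine ENNReal.toReal_pos (ne_of_gt ?_) (hRtop x)
    exact lt_of_lt_of_le (ENNReal.mul_pos (by simp) (hq0 x).ne') le_add_self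
  have hpow : ∀ x, (2 : ℝ) ^ (-(-Real.logb 2 (R x).toReal)) = (R x).toReal := fun x => by
    rw [neg_neg, Real.rpow_logb (by norm_num) (by norm_num) (hRpos x)]
  refine ⟨fun x => -Real.logb 2 (R x).toReal, ⟨?_, ?_⟩, fun x a h => ?_⟩
  · simp only [hpow]
    exact ENNReal.summable_toReal (hR1.trans_lt ENNReal.one_lt_top).ne
  · simp only [hpow]
    rw [← ENNReal.tsum_toReal_eq hRtop]
    exact ENNReal.toReal_le_of_le_ofReal zero_le_one (by simpa using hR1)
  · have h1 : ENNReal.ofReal (2⁻¹ * Real.exp (-a)) ≤ R x := by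
      rw [ENNReal.ofReal_mul (by norm_num)]
      refine le_trans ?_ (le_self_add : 2⁻¹ * Q x ≤ R x)
      gcongr
      rw [ENNReal.ofReal_inv_of_pos (by norm_num)]
      simp
    rw [ENNReal.ofReal_le_iff_le_toReal (hRtop x)] at h1
    have h2 := Real.log_le_log (by positivity) h1
    rw [Real.log_mul (by norm_num) (Real.exp_pos _).ne', Real.log_exp, Real.log_inv] at h2
    rw [neg_mul, Real.logb, div_mul_cancel₀ _ (Real.log_pos one_lt_two).ne']
    linarith

theorem sum_le_one_of_mem_monotonicDist {θ : ℕ+ → ℝ} (hθ : θ ∈ monotonicDist) (F : Finset ℕ) :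
    ∑ j ∈ F, θ j.succPNat ≤ 1 := by
  have h := sum_le_hasSum (F.map ⟨Nat.succPNat, Nat.succPNat_injective⟩) (fun i _ => hθ.1 i) hθ.2.1
  rwa [Finset.sum_map] at h

theorem seqProb_le_one {n : ℕ} {θ : ℕ+ → ℝ} (hθ : θ ∈ monotonicDist) (x : Fin n → ℕ+) :
    seqProb θ x ≤ 1 :=
  Finset.prod_le_one (fun _ _ => hθ.1 _) fun t _ =>
    le_hasSum hθ.2.1 (x t) fun i _ => hθ.1 i

theorem monotonicML_pos {n : ℕ} (x : Fin n → ℕ+) : 0 < monotonicML x := by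
  let θ : ℕ+ → ℝ := fun i => (1 / 2 : ℝ) ^ (i : ℕ)
  have hθ : θ ∈ monotonicDist := by
    refine ⟨fun i => by positivity, ?_, fun i j hij => ?_⟩
    · rw [← Equiv.pnatEquivNat.symm.hasSum_iff]
      convert hasSum_geometric_two' 1 using 2 with k
      simp [θ, pow_succ, Equiv.pnatEquivNat]
      ring
    · exact pow_le_pow_of_le_one (by norm_num) (by norm_num) hij
  have h1 : seqProb θ x ≤ monotonicML x := by
    refine le_ciSup (f := fun θ : monotonicDist => seqProb (θ : ℕ+ → ℝ) x) ⟨1, ?_⟩ ⟨θ, hθ⟩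
    rintro _ ⟨θ', rfl⟩
    exact seqProb_le_one θ'.2 x
  exact lt_of_lt_of_le (Finset.prod_pos fun t _ => by positivity) h1

theorem exists_codeLength_of_achievable {n : ℕ} {w : ℕ → ℝ} {I : Type*} {p : I → ℝ}
    (hp : ∀ i, 0 < p i) (hp1 : IsSubProb fun i => ENNReal.ofReal (p i)) (M : I → ℕ) (U : I → ℝ) :
    ∃ L : (Fin n → ℕ+) → ℝ, IsCodeLength L ∧
      ∀ i, IsAchievableCost n (M i) w (U i) → ∀ x, L x * Real.log 2 + Real.log (monotonicML x) ≤
        U i - Real.log (p i) + 2 * Real.log 2 +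
          ∑ b ∈ (Finset.univ.image x).filter (fun b : ℕ+ => M i < b),
            (Real.log 2 + Real.log n - Real.log (w b.natPred)) := by
  classical
  have hex : ∀ i, ∃ Q : (Fin n → ℕ) → ℝ≥0∞, IsSubProb Q ∧ (IsAchievableCost n (M i) w (U i) →
      ∀ (y : Fin n → ℕ) (θ : ℕ → ℝ), (∀ j, 0 ≤ θ j) → (∀ F : Finset ℕ, ∑ j ∈ F, θ j ≤ 1) →
      Antitone θ →
      ENNReal.ofReal ((∏ t, θ (y t)) * Real.exp (-(U i + (Real.log 2 +
        ∑ j ∈ (Finset.univ.image y).filter (M i ≤ ·),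
          (Real.log 2 + Real.log n - Real.log (w j)))))) ≤ Q y) := by
    intro i
    by_cases h : IsAchievableCost n (M i) w (U i)
    · obtain ⟨Q, hQ, hQ'⟩ := h
      exact ⟨Q, hQ, fun _ => hQ'⟩
    -- Indices whose cost is not achievable receive the zero measure; their prior weight is merely
    -- wasted.
    · exact ⟨0, by simp [IsSubProb], fun h' => absurd h' h⟩
  choose Q hQ hQ' using hex
  have hmix : IsSubProb fun x : Fin n → ℕ+ =>
      ∑' i, ENNReal.ofReal (p i) * Q i (fun t => (x t).natPred) := by
    have h := IsSubProb.mixture hp1 hQ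
    unfold IsSubProb at h ⊢
    rw [← (Equiv.arrowCongr (Equiv.refl (Fin n)) Equiv.pnatEquivNat).tsum_eq] at h
    exact h
  obtain ⟨L, hL, hL'⟩ := exists_codeLength_of_isSubProb hmix
  refine ⟨L, hL, fun i hi x => ?_⟩
  set y : Fin n → ℕ := fun t => (x t).natPred with hy
  set A := U i + (Real.log 2 + ∑ j ∈ (Finset.univ.image y).filter (M i ≤ ·),
          (Real.log 2 + Real.log n - Real.log (w j))) with hA
  have hsum : ∑ j ∈ (Finset.univ.image y).filter (M i ≤ ·),
      (Real.log 2 + Real.log n - Real.log (w j)) =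
      ∑ b ∈ (Finset.univ.image x).filter (fun b : ℕ+ => M i < b),
            (Real.log 2 + Real.log n - Real.log (w b.natPred)) := by
    -- Symbols are shifted to start at 0, so `M ≤ y t` means `M < x t`.
    have h1 : (Finset.univ.image y).filter (M i ≤ ·) =
        ((Finset.univ.image x).filter (fun b : ℕ+ => M i < b)).image PNat.natPred := by
      rw [show y = PNat.natPred ∘ x from rfl, ← Finset.image_image, Finset.filter_image]
      congr 2
      funext b
      have := PNat.natPred_add_one b
      simp only [eq_iff_iff]
      omega
    rw [h1, Finset.sum_image fun a _ b _ h => PNat.natPred_injective h]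
  have hθ : ∀ θ ∈ monotonicDist, 0 < seqProb θ x →
      seqProb θ x ≤ Real.exp (A - Real.log (p i) + Real.log 2 - L x * Real.log 2) := by
    intro θ hθ hpos
    have hprod : ∏ t, θ (y t).succPNat = seqProb θ x := by
      simp [seqProb, hy]
    have h1 := hQ' i hi y (fun j => θ j.succPNat) (fun j => hθ.1 _)
      (sum_le_one_of_mem_monotonicDist hθ) fun a b hab => hθ.2.2 (Nat.succPNat_mono hab)
    simp only [hprod] at h1
    have h2 := hL' x (A - Real.log (p i) - Real.log (seqProb θ x)) (by
      refine le_trans ?_ (ENNReal.le_tsum i)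
      refine le_trans (le_of_eq ?_) (mul_le_mul_right h1 _)
      rw [← ENNReal.ofReal_mul (hp i).le]
      congr 1
      rw [show -(A - Real.log (p i) - Real.log (seqProb θ x)) =
        Real.log (p i) + (Real.log (seqProb θ x) + -A) by ring, Real.exp_add, Real.exp_add,
        Real.exp_log (hp i), Real.exp_log hpos])
    rw [← Real.log_le_iff_le_exp hpos]
    linarith
  have hML : monotonicML x ≤ Real.exp (A - Real.log (p i) + Real.log 2 - L x * Real.log 2) := by
    refine Real.iSup_le (fun θ => ?_) (Real.exp_pos _).le
    rcases le_or_gt (seqProb (θ : ℕ+ → ℝ) x) 0 with h | h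
    · exact h.trans (Real.exp_pos _).le
    · exact hθ θ θ.2 h
  have h3 := (Real.log_le_iff_le_exp (monotonicML_pos x)).2 hML
  rw [← hsum]
  linarith

theorem isSubProb_telescoping :
    IsSubProb fun a : ℕ => ENNReal.ofReal (1 / (((a : ℝ) + 1) * (a + 2))) := by
  unfold IsSubProb
  refine ENNReal.tsum_le_of_sum_range_le fun n => ?_
  rw [← ENNReal.ofReal_sum_of_nonneg (fun _ _ => by positivity)]
  have : ∀ n : ℕ, ∑ a ∈ Finset.range n, 1 / (((a : ℝ) + 1) * (a + 2)) = 1 - 1 / (n + 1) := by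
    intro n
    induction n with
    | zero => simp
    | succ n ih =>
      rw [Finset.sum_range_succ, ih]
      push_cast
      field_simp
      ring
  rw [this]
  refine ENNReal.ofReal_le_one.2 ?_
  have : (0 : ℝ) ≤ 1 / (n + 1) := by positivity
  linarith

theorem neg_log_telescoping_le (a : ℕ) :
    -Real.log (1 / (((a : ℝ) + 1) * (a + 2))) ≤ 2 * Real.log (a + 2) := by
  rw [one_div, Real.log_inv, neg_neg, Real.log_mul (by positivity) (by positivity)]
  have : Real.log ((a : ℝ) + 1) ≤ Real.log (a + 2) :=
    Real.log_le_log (by positivity) (by linarith)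
  linarith

/-- A sequence of codes whose redundancies, in nats, are bounded simultaneously for all
alphabet sizes `M` and precisions `D`. -/
theorem exists_universal_code {κ : ℝ} (hκ : 0 < κ) :
    ∃ C : ℝ, 0 ≤ C ∧ ∃ L : (n : ℕ) → (Fin n → ℕ+) → ℝ, (∀ n, IsCodeLength (L n)) ∧
      ∀ (n M : ℕ) (x : Fin n → ℕ+), 1 ≤ M →
        let R := L n x * Real.log 2 + Real.log (monotonicML x)
        let S := ∑ b ∈ (Finset.univ.image x).filter (fun b : ℕ+ => M < b),
          (C + Real.log n + (1 + κ) * Real.log (b : ℕ))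
        (M ≤ n → R ≤ M * (Real.log (n / M) / 2) + 6 * M + 2 * Real.log (M + 2) + C + S) ∧
        (M ^ 2 ≤ n → R ≤ M * Real.log (n / M ^ 2) + 5 * M + 2 * Real.log (M + 2) + C + S) ∧
        ∀ D : ℕ, 1 ≤ D → R ≤ (2 * (D * Nat.clog 2 (M * D)) + 1) * Real.log 2 + 4 * n / D +
          2 * Real.log (M + 2) + 2 * Real.log (D + 3) + C + S := by
  have hsum : Summable fun j : ℕ => ((j : ℝ) + 1) ^ (-(1 + κ)) := by
    have h := (summable_nat_add_iff 1).2 (Real.summable_nat_rpow (p := -(1 + κ)) |>.2 (by linarith))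
    simpa using h
  set Z := ∑' j : ℕ, ((j : ℝ) + 1) ^ (-(1 + κ)) with hZ
  have hnn : ∀ j : ℕ, 0 < ((j : ℝ) + 1) ^ (-(1 + κ)) := fun j => by positivity
  have hZ1 : 1 ≤ Z := by
    have := hsum.le_tsum 0 fun j _ => (hnn j).le
    rwa [Nat.cast_zero, zero_add, Real.one_rpow] at this
  have hZ0 : 0 < Z := by linarith
  set w : ℕ → ℝ := fun j => ((j : ℝ) + 1) ^ (-(1 + κ)) / Z with hwdef
  have hw : ∀ j, 0 < w j := fun j => div_pos (hnn j) hZ0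
  have hw1 : IsSubProb fun j => ENNReal.ofReal (w j) := by
    refine isSubProb_of_hasSum (a := 1) (fun j => (hw j).le) ?_ le_rfl
    have := hsum.hasSum.div_const Z
    rwa [← hZ, div_self hZ0.ne'] at this
  have hlogw : ∀ b : ℕ+, -Real.log (w b.natPred) = (1 + κ) * Real.log (b : ℕ) + Real.log Z := by
    intro b
    have h1 : ((b.natPred : ℝ) + 1) = (b : ℕ) := by exact_mod_cast PNat.natPred_add_one b
    have h2 : (0 : ℝ) < (b : ℕ) := by exact_mod_cast b.pos
    simp only [hwdef]
    rw [h1, Real.log_div (by positivity) hZ0.ne', Real.log_rpow h2]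
    ring
  -- The first index is 0 for the square-root code, 1 for the difference code and `D + 2` for the
  -- level-set code of precision `D + 1`; the second is `M`.
  let U : (n : ℕ) → ℕ × ℕ → ℝ := fun n i => match i.1 with
    | 0 => i.2 * (Real.log (n / i.2) / 2) + 6 * i.2
    | 1 => i.2 * Real.log (n / i.2 ^ 2) + 5 * i.2
    | D + 2 => (2 * ((D + 1 : ℕ) * Nat.clog 2 (i.2 * (D + 1))) + 1) * Real.log 2 +
        4 * n / (D + 1 : ℕ)
  let p : ℕ × ℕ → ℝ := fun i => 1 / (((i.1 : ℝ) + 1) * (i.1 + 2)) * (1 / (((i.2 : ℝ) + 1) * (i.2 + 2)))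
  have hp : ∀ i, 0 < p i := fun i => by positivity
  have hp1 : IsSubProb fun i => ENNReal.ofReal (p i) := by
    have h := IsSubProb.prod isSubProb_telescoping isSubProb_telescoping
    convert h using 2 with i
    exact ENNReal.ofReal_mul (by positivity)
  have hlogp : ∀ i, -Real.log (p i) ≤ 2 * Real.log (i.1 + 2) + 2 * Real.log (i.2 + 2) := by
    intro i
    simp only [p]
    rw [Real.log_mul (by positivity) (by positivity)]
    have := neg_log_telescoping_le i.1
    have := neg_log_telescoping_le i.2
    linarith
  choose L hL hL' using fun n => exists_codeLength_of_achievable (n := n) (w := w) hp hp1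
    (fun i => i.2) (U n)
  have hlog2 := Real.log_pos one_lt_two
  have hlogZ := Real.log_nonneg hZ1
  have hlog3 : Real.log 2 ≤ Real.log 3 := Real.log_le_log (by norm_num) (by norm_num)
  -- `2 log 3` covers the prior of kinds 0 and 1, `2 log 2` the two extra bits, and `log Z` the
  -- normalisation of `w`.
  refine ⟨2 * Real.log 3 + 2 * Real.log 2 + Real.log Z, by linarith, L, hL,
    fun n M x hM => ?_⟩
  intro R S
  have hS : ∑ b ∈ (Finset.univ.image x).filter (fun b : ℕ+ => M < b),
      (Real.log 2 + Real.log n - Real.log (w b.natPred)) ≤ S := by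
    refine Finset.sum_le_sum fun b _ => ?_
    linarith [hlogw b]
  refine ⟨fun h => ?_, fun h => ?_, fun D hD => ?_⟩
  · have h1 := hL' n (0, M) (isAchievableCost_smallAlphabet hM h hw hw1) x
    have h2 := hlogp (0, M)
    simp only [Nat.cast_zero, zero_add, U] at h1 h2
    linarith
  · have h1 := hL' n (1, M) (isAchievableCost_mediumAlphabet hM h hw hw1) x
    have h2 := hlogp (1, M)
    simp only [Nat.cast_one, show (1 : ℝ) + 2 = 3 by norm_num, U] at h1 h2
    linarith
  · obtain ⟨D, rfl⟩ := Nat.exists_eq_add_of_le' hD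
    have h1 := hL' n (D + 2, M) (isAchievableCost_largeAlphabet hM hD hw hw1) x
    have h2 := hlogp (D + 2, M)
    simp only [U] at h1 h2
    have h3 : ((D + 2 : ℕ) : ℝ) + 2 = ((D + 1 : ℕ) : ℝ) + 3 := by push_cast; ring
    rw [h3] at h2
    linarith

/-! ### Absorbing the overheads into the stated costs. -/

theorem le_two_mul_floor {m : ℝ} (hm : 1 ≤ m) : m ≤ 2 * ⌊m⌋₊ := by
  have h1 := Nat.lt_floor_add_one m
  have h2 : (1 : ℝ) ≤ ⌊m⌋₊ := by exact_mod_cast Nat.le_floor (by simpa using hm)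
  linarith

theorem log_floor_add_two_le {m : ℝ} (hm : 1 ≤ m) :
    2 * Real.log (⌊m⌋₊ + 2) ≤ 2 * (m + 1) := by
  have h1 := Real.log_le_sub_one_of_pos (show (0 : ℝ) < ⌊m⌋₊ + 2 by positivity)
  have h2 := Nat.floor_le (show 0 ≤ m by linarith)
  linarith

/-- The spare `ε m Λ / 2`, with `Λ = log (N / m)`, is split evenly: one half pays the `O(m)`
overhead, the other the passage from `m` to `m - 1`. -/
theorem smallAlphabet_cost_le {ε C m N : ℝ} (hε : 0 < ε) (hC : 0 ≤ C) (hm : 1 ≤ m) (hN : 0 < N)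
    (h1 : 1 + ε ≤ ε * m / 2) (h2 : 11 + C ≤ ε * Real.log (N / m) / 4) :
    ⌊m⌋₊ * (Real.log (N / ⌊m⌋₊) / 2) + 6 * ⌊m⌋₊ + 2 * Real.log (⌊m⌋₊ + 2) + C ≤
      (1 + ε) * ((m - 1) / 2 * Real.log (N / m)) := by
  have hM2 := le_two_mul_floor hm
  have hlog := log_floor_add_two_le hm
  have hMm := Nat.floor_le (show 0 ≤ m by linarith)
  set M : ℝ := ((⌊m⌋₊ : ℕ) : ℝ)
  have hM0 : 0 < M := by linarith
  set Λ := Real.log (N / m)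
  have hΛ : 0 ≤ Λ := by
    by_contra h
    nlinarith
  have h3 : Real.log (N / M) ≤ Λ + 1 := by
    have h4 : Real.log (N / M) ≤ Real.log (N / m * 2) := by
      refine Real.log_le_log (by positivity) ?_
      rw [div_mul_eq_mul_div, div_le_div_iff₀ hM0 (by linarith)]
      nlinarith
    rw [Real.log_mul (by positivity) (by norm_num)] at h4
    linarith [Real.log_two_lt_d9]
  have h5 : M * (Real.log (N / M) / 2) ≤ m * ((Λ + 1) / 2) := by
    calc M * (Real.log (N / M) / 2) ≤ M * ((Λ + 1) / 2) := by gcongr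
      _ ≤ _ := by gcongr
  have h6 : m * (11 + C) ≤ m * (ε * Λ / 4) := by gcongr
  have h7 : Λ * (1 + ε) ≤ Λ * (ε * m / 2) := by gcongr
  nlinarith

theorem mediumAlphabet_cost_le {ε C m N : ℝ} (hε : 0 < ε) (hC : 0 ≤ C) (hm : 1 ≤ m) (hN : 0 < N)
    (h2 : 11 + C ≤ ε * Real.log (N / m ^ 2)) :
    ⌊m⌋₊ * Real.log (N / (⌊m⌋₊ : ℝ) ^ 2) + 5 * ⌊m⌋₊ + 2 * Real.log (⌊m⌋₊ + 2) + C ≤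
      (1 + ε) * (m * Real.log (N / m ^ 2)) := by
  have hM2 := le_two_mul_floor hm
  have hlog := log_floor_add_two_le hm
  have hMm := Nat.floor_le (show 0 ≤ m by linarith)
  set M : ℝ := ((⌊m⌋₊ : ℕ) : ℝ)
  have hM0 : 0 < M := by linarith
  set Λ := Real.log (N / m ^ 2)
  have hΛ : 0 ≤ Λ := by
    by_contra h
    nlinarith
  have h3 : Real.log (N / M ^ 2) ≤ Λ + 2 := by
    have h4 : Real.log (N / M ^ 2) ≤ Real.log (N / m ^ 2 * 4) := by
      refine Real.log_le_log (by positivity) ?_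
      rw [div_mul_eq_mul_div, div_le_div_iff₀ (by positivity) (by positivity)]
      have : m ^ 2 ≤ (2 * M) ^ 2 := by gcongr
      nlinarith
    rw [Real.log_mul (by positivity) (by norm_num), show (4 : ℝ) = 2 ^ 2 by norm_num,
      Real.log_pow] at h4
    have := Real.log_two_lt_d9
    push_cast at h4
    linarith
  have h5 : M * Real.log (N / M ^ 2) ≤ m * (Λ + 2) := by
    calc M * Real.log (N / M ^ 2) ≤ M * (Λ + 2) := by gcongr
      _ ≤ _ := by gcongr
  have h6 : m * (11 + C) ≤ m * (ε * Λ) := by gcongr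
  nlinarith

theorem clog_mul_log_two_le {a : ℕ} (ha : 1 ≤ a) :
    Nat.clog 2 a * Real.log 2 ≤ Real.log a + Real.log 2 := by
  have h2 := Real.log_pos one_lt_two
  have h0 : 0 ≤ Real.log a := Real.log_nonneg (by exact_mod_cast ha)
  rcases ha.eq_or_lt with h | h
  · subst h; simp; exact h2.le
  · have h1 := Nat.pow_pred_clog_lt_self (b := 2) (by norm_num) h
    have h3 : ((2 : ℝ)) ^ (Nat.clog 2 a).pred ≤ a := by exact_mod_cast h1.le
    have h4 := Real.log_le_log (by positivity) h3
    rw [Real.log_pow] at h4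
    have h5 : ((Nat.clog 2 a : ℕ) : ℝ) ≤ (Nat.clog 2 a).pred + 1 := by
      have : Nat.clog 2 a ≤ (Nat.clog 2 a).pred + 1 := by rw [Nat.pred_eq_sub_one]; omega
      exact_mod_cast this
    nlinarith

theorem exists_precision_cost_le {n : ℕ} {ρ α C : ℝ} (hC : 0 ≤ C) (hn : 1 ≤ Real.log n)
    (hρ : 0 ≤ ρ) (hα : 0 ≤ α) :
    ∃ D : ℕ, 1 ≤ D ∧
      (2 * (D * Nat.clog 2 (⌊(n : ℝ) ^ ρ⌋₊ * D)) + 1) * Real.log 2 + 4 * n / D +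
        2 * Real.log (⌊(n : ℝ) ^ ρ⌋₊ + 2) + 2 * Real.log (D + 3) + C ≤
      (n : ℝ) ^ (1 - α) + (70 + C) * (ρ + α + 1) * Real.log n * (n : ℝ) ^ α := by
  have hn1 : (1 : ℝ) < n := by
    by_contra h
    have := Real.log_nonpos (Nat.cast_nonneg n) (not_lt.1 h)
    linarith
  have hn0 : (0 : ℝ) < n := by linarith
  set l := Real.log n with hl
  have hm : (1 : ℝ) ≤ (n : ℝ) ^ ρ := Real.one_le_rpow hn1.le hρ
  have hX : (1 : ℝ) ≤ (n : ℝ) ^ α := Real.one_le_rpow hn1.le hα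
  have hlm : Real.log ((n : ℝ) ^ ρ) = ρ * l := Real.log_rpow hn0 _
  have hlX : Real.log ((n : ℝ) ^ α) = α * l := Real.log_rpow hn0 _
  rw [Real.rpow_sub hn0, Real.rpow_one]
  set m := (n : ℝ) ^ ρ
  set X := (n : ℝ) ^ α
  have hMm := Nat.floor_le (show 0 ≤ m by linarith)
  have hM1 : 1 ≤ ⌊m⌋₊ := Nat.le_floor (by simpa using hm)
  have hM1' : (1 : ℝ) ≤ ⌊m⌋₊ := by exact_mod_cast hM1
  -- The factor 4 turns `4 n / D` into `n ^ (1 - α)` with coefficient 1; the target has 3.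
  have hD1 := Nat.le_ceil (4 * X)
  have hD2 := (Nat.ceil_lt_add_one (show 0 ≤ 4 * X by linarith)).le
  set D := ⌈4 * X⌉₊
  have hD0 : (0 : ℝ) < D := by linarith
  have hD3 : (D : ℝ) ≤ 5 * X := by linarith
  have hDpos : 1 ≤ D := by exact_mod_cast hD0
  refine ⟨D, hDpos, ?_⟩
  have hlog2 := Real.log_pos one_lt_two
  have hlog2' := Real.log_two_lt_d9
  have hρl : 0 ≤ ρ * l := by positivity
  have hαl : 0 ≤ α * l := by positivity
  have e1 : Nat.clog 2 (⌊m⌋₊ * D) * Real.log 2 ≤ ρ * l + α * l + 5 := by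
    refine (clog_mul_log_two_le (Nat.mul_pos hM1 hDpos)).trans ?_
    push_cast
    have h5 := Real.log_le_sub_one_of_pos (show (0 : ℝ) < 5 by norm_num)
    have h6 : Real.log (⌊m⌋₊ * D) ≤ Real.log (m * (5 * X)) :=
      Real.log_le_log (by positivity) (by gcongr)
    rw [Real.log_mul (x := m) (by linarith) (by linarith),
      Real.log_mul (y := X) (by norm_num) (by linarith), hlm, hlX] at h6
    linarith
  have e2 : 4 * n / (D : ℝ) ≤ n / X := by
    rw [div_le_div_iff₀ hD0 (by linarith)]
    nlinarith
  have e3 : 2 * Real.log (⌊m⌋₊ + 2) ≤ 2 * (ρ * l) + 4 := by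
    have h6 : Real.log ((⌊m⌋₊ : ℝ) + 2) ≤ Real.log (3 * m) :=
      Real.log_le_log (by positivity) (by linarith)
    rw [Real.log_mul (by norm_num) (by positivity), hlm] at h6
    have h5 := Real.log_le_sub_one_of_pos (show (0 : ℝ) < 3 by norm_num)
    linarith
  have e4 : 2 * Real.log ((D : ℝ) + 3) ≤ 2 * (α * l) + 14 := by
    have h6 : Real.log ((D : ℝ) + 3) ≤ Real.log (8 * X) :=
      Real.log_le_log (by positivity) (by linarith)
    rw [Real.log_mul (by norm_num) (by positivity), hlX] at h6
    have h5 := Real.log_le_sub_one_of_pos (show (0 : ℝ) < 8 by norm_num)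
    linarith
  have e5 : 2 * ((D : ℝ) * (Nat.clog 2 (⌊m⌋₊ * D) * Real.log 2)) ≤
      10 * (ρ * l + α * l + 5) * X := by
    calc 2 * ((D : ℝ) * (Nat.clog 2 (⌊m⌋₊ * D) * Real.log 2)) ≤
        2 * ((5 * X) * (ρ * l + α * l + 5)) := by gcongr
      _ = _ := by ring
  have e6 : 10 * (ρ * l + α * l + 5) * X + (2 * (ρ * l) + 2 * (α * l) + 19 + C) ≤
      (12 * (ρ * l + α * l) + (69 + C)) * X := by
    have : (2 * (ρ * l) + 2 * (α * l) + 19 + C) * 1 ≤ (2 * (ρ * l) + 2 * (α * l) + 19 + C) * X := by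
      gcongr
    linarith
  have e7 : (12 * (ρ * l + α * l) + (69 + C)) * X ≤ (70 + C) * (ρ + α + 1) * l * X := by
    have h8 : 0 ≤ C * (ρ * l + α * l) := by positivity
    have h9 : (70 + C) * 1 ≤ (70 + C) * l := by gcongr
    have : 12 * (ρ * l + α * l) + (69 + C) ≤ (70 + C) * (ρ + α + 1) * l := by linarith
    gcongr
  linarith

/-- The cost of large alphabets at the tradeoff exponent `α`, in nats. -/
noncomputable def tradeoffCost (n : ℕ) (ρ α : ℝ) : ℝ :=
  (ρ + 1 + α) / 2 * (ρ - α) * (Real.log n ^ 2 / Real.log 2) * (n : ℝ) ^ α + 3 * (n : ℝ) ^ (1 - α)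

/-- The target has one more factor `log n` than the code needs; as `ρ - α ≥ ε`, it beats the
constant `P`. -/
theorem le_tradeoffCost_of_nonneg {n : ℕ} {ε ρ α P : ℝ} (hε : 0 < ε) (hα : 0 ≤ α)
    (hαρ : α ≤ ρ - ε) (hn : 1 ≤ Real.log n) (hP : P ≤ ε / 2 * Real.log n) :
    (n : ℝ) ^ (1 - α) + P * (ρ + α + 1) * Real.log n * (n : ℝ) ^ α ≤ tradeoffCost n ρ α := by
  unfold tradeoffCost
  have hX : 0 ≤ (n : ℝ) ^ α := by positivity
  have hY : 0 ≤ (n : ℝ) ^ (1 - α) := by positivity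
  set l := Real.log n
  have hlog2 := Real.log_pos one_lt_two
  have h1 : l ^ 2 ≤ l ^ 2 / Real.log 2 := by
    rw [le_div_iff₀ hlog2]
    nlinarith [Real.log_two_lt_d9, sq_nonneg l]
  have h2 : P * (ρ + α + 1) * l ≤ (ρ + 1 + α) / 2 * (ρ - α) * (l ^ 2 / Real.log 2) := by
    have h3 : 0 ≤ ρ + α + 1 := by linarith
    calc P * (ρ + α + 1) * l ≤ (ε / 2 * l) * (ρ + α + 1) * l := by gcongr
      _ = (ρ + 1 + α) / 2 * ε * l ^ 2 := by ring
      _ ≤ (ρ + 1 + α) / 2 * (ρ - α) * (l ^ 2 / Real.log 2) := by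
        have : 0 ≤ ρ - α := by linarith
        have : 0 ≤ (ρ + 1 + α) / 2 := by linarith
        gcongr
        linarith
  have h4 := mul_le_mul_of_nonneg_right h2 hX
  linarith

/-- The minimum also ranges over negative `α`, where the code of exponent 0 is used. If the
quadratic coefficient stays positive, AM-GM on `n ^ α` and `n ^ (1 - α)`, whose product is `n`,
bounds the parameter cost, and a third copy of `n ^ (1 - α)` covers `n`. -/
theorem le_tradeoffCost_of_neg {n : ℕ} {ε ρ α P : ℝ} (hε : 0 < ε) (hρ : ε ≤ ρ) (hα : α < 0)
    (hP0 : 0 ≤ P) (hn : 1 ≤ Real.log n) (hn3 : 3 ≤ n) (hP : 2 * P ≤ n)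
    (hP2 : P ^ 2 * (1 + ε) ≤ 2 * ε * n) :
    (n : ℝ) + P * (ρ + 1) * Real.log n ≤ tradeoffCost n ρ α := by
  unfold tradeoffCost
  have hn3' : (3 : ℝ) ≤ n := by exact_mod_cast hn3
  have hn0 : (0 : ℝ) < n := by linarith
  have hX : 0 < (n : ℝ) ^ α := by positivity
  have hY : 0 < (n : ℝ) ^ (1 - α) := by positivity
  have hXY : (n : ℝ) ^ α * (n : ℝ) ^ (1 - α) = n := by
    rw [← Real.rpow_add hn0]; simp
  have hYn : (n : ℝ) ≤ (n : ℝ) ^ (1 - α) := by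
    have := Real.rpow_le_rpow_of_exponent_le (show (1 : ℝ) ≤ n by linarith)
      (show 1 ≤ 1 - α by linarith)
    simpa using this
  have hlog2 := Real.log_pos one_lt_two
  have hlog2' := Real.log_two_lt_d9
  have hlog2'' := Real.log_two_gt_d9
  rcases le_or_gt (-(ρ + 1) / 2) α with h | h
  · set X := (n : ℝ) ^ α
    set Y := (n : ℝ) ^ (1 - α)
    set l := Real.log n
    set A := (ρ + 1 + α) / 2 * (ρ - α) * (l ^ 2 / Real.log 2) with hA
    have h1 : l ^ 2 ≤ l ^ 2 / Real.log 2 := by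
      rw [le_div_iff₀ hlog2]
      nlinarith [sq_nonneg l]
    have h2 : (ρ + 1) / 4 * ρ * l ^ 2 ≤ A := by
      have : 0 < ρ := by linarith
      have : (ρ + 1) / 4 ≤ (ρ + 1 + α) / 2 := by linarith
      have h0 : 0 ≤ (ρ + 1 + α) / 2 := by linarith
      have h0' : 0 ≤ (ρ + 1 + α) / 2 * (ρ - α) := mul_nonneg h0 (by linarith)
      rw [hA]
      gcongr
      linarith
    have h3 : ε * (ρ + 1) ≤ (1 + ε) * ρ := by nlinarith
    have hA0 : 0 ≤ A := le_trans (by have : 0 < ρ := by linarith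
                                     positivity) h2
    have h4 : (P * (ρ + 1) * l) ^ 2 ≤ (A * X + 2 * Y) ^ 2 := by
      have h5 : (A * X + 2 * Y) ^ 2 ≥ 8 * A * n := by
        rw [← hXY]
        nlinarith [sq_nonneg (A * X - 2 * Y)]
      have h6 : (P * (ρ + 1) * l) ^ 2 * (1 + ε) ≤ 8 * A * n * (1 + ε) := by
        calc (P * (ρ + 1) * l) ^ 2 * (1 + ε) = (P ^ 2 * (1 + ε)) * ((ρ + 1) ^ 2 * l ^ 2) := by ring
          _ ≤ (2 * ε * n) * ((ρ + 1) ^ 2 * l ^ 2) := by gcongr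
          _ = 2 * n * ((ρ + 1) * l ^ 2) * (ε * (ρ + 1)) := by ring
          _ ≤ 2 * n * ((ρ + 1) * l ^ 2) * ((1 + ε) * ρ) := by
            have : 0 ≤ ρ + 1 := by linarith
            gcongr
          _ = 8 * ((ρ + 1) / 4 * ρ * l ^ 2) * n * (1 + ε) := by ring
          _ ≤ 8 * A * n * (1 + ε) := by gcongr
      have h7 := le_of_mul_le_mul_right h6 (by linarith)
      linarith
    have h8 : P * (ρ + 1) * l ≤ A * X + 2 * Y := le_of_sq_le_sq h4 (by positivity)
    linarith
  -- Here the first term may be negative, but `u ^ 2 * exp (-u) ≤ 2` at `u = β log n` keeps it above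
  -- `-6`, and `3 n exp u` dominates everything.
  · obtain ⟨β, rfl⟩ : ∃ β, α = -β := ⟨-α, by ring⟩
    have hβ : 0 < β := by linarith
    have hρβ : ρ + 1 < 2 * β := by linarith
    set l := Real.log n with hl
    have hXe : (n : ℝ) ^ (-β) = Real.exp (-(β * l)) := by
      rw [Real.rpow_def_of_pos hn0]; congr 1; ring
    have hYe : (n : ℝ) ^ (1 - -β) = n * Real.exp (β * l) := by
      rw [sub_neg_eq_add, Real.rpow_add hn0, Real.rpow_one, Real.rpow_def_of_pos hn0]
      congr 2; ring
    rw [hXe, hYe] at *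
    have hβl : 0 ≤ β * l := by positivity
    have h1 : (β * l) ^ 2 * Real.exp (-(β * l)) ≤ 2 := by
      rw [Real.exp_neg, ← div_eq_mul_inv, div_le_iff₀ (Real.exp_pos _)]
      have := Real.quadratic_le_exp_of_nonneg hβl
      nlinarith
    have h2 : -(3 / 2 * β ^ 2) ≤ (ρ + 1 + -β) / 2 * (ρ - -β) := by
      nlinarith [mul_nonneg (show 0 ≤ ρ by linarith) (show 0 ≤ ρ by linarith)]
    have h3 : -6 ≤ (ρ + 1 + -β) / 2 * (ρ - -β) * (l ^ 2 / Real.log 2) * Real.exp (-(β * l)) := by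
      have h4 : l ^ 2 / Real.log 2 ≤ 2 * l ^ 2 := by
        rw [div_le_iff₀ hlog2]
        nlinarith [sq_nonneg l]
      have h5 : 0 ≤ l ^ 2 / Real.log 2 := by positivity
      calc (-6 : ℝ) ≤ -(3 / 2 * 2 * ((β * l) ^ 2 * Real.exp (-(β * l)))) := by linarith
        _ = -(3 / 2 * β ^ 2 * (2 * l ^ 2) * Real.exp (-(β * l))) := by ring
        _ ≤ -(3 / 2 * β ^ 2 * (l ^ 2 / Real.log 2) * Real.exp (-(β * l))) := by gcongr
        _ = -(3 / 2 * β ^ 2) * (l ^ 2 / Real.log 2) * Real.exp (-(β * l)) := by ring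
        _ ≤ _ := by gcongr
    have h6 : β * l + 1 ≤ Real.exp (β * l) := Real.add_one_le_exp _
    have h7 : P * (ρ + 1) * l ≤ n * (β * l) := by
      calc P * (ρ + 1) * l ≤ P * (2 * β) * l := by gcongr
        _ = (2 * P) * (β * l) := by ring
        _ ≤ n * (β * l) := by gcongr
    have h8 : n * (β * l + 1) ≤ n * Real.exp (β * l) := by gcongr
    nlinarith

/-! ### The three regions and the final bound. -/

theorem effectiveAlphabetCost_mul_log_two_of_le {ε ρ : ℝ} {b : ℕ → ℝ} {n : ℕ}
    (h : (n : ℝ) ^ ρ ≤ (n : ℝ) ^ (1 / 3 : ℝ)) :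
    effectiveAlphabetCost ε b n ρ * Real.log 2 =
      ((n : ℝ) ^ ρ - 1) / 2 * Real.log (n / (n : ℝ) ^ ρ) := by
  have := Real.log_pos one_lt_two
  simp only [effectiveAlphabetCost, if_pos h, Real.logb]
  field_simp

theorem effectiveAlphabetCost_mul_log_two_of_lt {ε ρ : ℝ} {b : ℕ → ℝ} {n : ℕ}
    (h : ¬ (n : ℝ) ^ ρ ≤ (n : ℝ) ^ (1 / 3 : ℝ)) (hb : (n : ℝ) ^ ρ ≤ b n) :
    effectiveAlphabetCost ε b n ρ * Real.log 2 =
      (n : ℝ) ^ ρ * Real.log (n / ((n : ℝ) ^ ρ) ^ 2) := by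
  have := Real.log_pos one_lt_two
  simp only [effectiveAlphabetCost, if_neg h, if_pos hb, Real.logb]
  field_simp

theorem le_effectiveAlphabetCost {ε ρ c : ℝ} {b : ℕ → ℝ} {n : ℕ}
    (h : ¬ (n : ℝ) ^ ρ ≤ (n : ℝ) ^ (1 / 3 : ℝ)) (hb : ¬ (n : ℝ) ^ ρ ≤ b n)
    (hc : ∀ α ≤ ρ - ε, c ≤ tradeoffCost n ρ α) :
    c ≤ effectiveAlphabetCost ε b n ρ * Real.log 2 := by
  have h2 := Real.log_pos one_lt_two
  rw [← div_le_iff₀ h2]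
  simp only [effectiveAlphabetCost, if_neg h, if_neg hb]
  have : Nonempty (Set.Iic (ρ - ε)) := ⟨⟨ρ - ε, Set.mem_Iic.2 le_rfl⟩⟩
  refine le_ciInf fun α => ?_
  rw [div_le_iff₀ h2]
  refine (hc α α.2).trans (le_of_eq ?_)
  rw [tradeoffCost, Real.logb, Real.logb, Real.log_exp]
  field_simp

/-- A symbol `i > n ^ ρ` has `log n ≤ (1 / ρ) log i`, the source of the factor `1 + 1 / ρ`. As `log
i ≥ ε log n`, the constant `C` costs at most `ε / 2` of `log i`. -/
theorem largeSymbolCost_nats_le {n : ℕ} {ε ρ C : ℝ} (hε : 0 < ε) (hρ : ε < ρ)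
    (hn : 1 ≤ Real.log n) (hC : C ≤ ε / 2 * (ε * Real.log n)) (x : Fin n → ℕ+) :
    ∑ i ∈ (Finset.univ.image x).filter (fun i : ℕ+ => ⌊(n : ℝ) ^ ρ⌋₊ < i),
      (C + Real.log n + (1 + ε / 2) * Real.log (i : ℕ)) ≤
      (1 + ε) * ((1 + 1 / ρ) * largeSymbolCost ρ x * Real.log 2) := by
  have h2 := Real.log_pos one_lt_two
  have hρ0 : 0 < ρ := hε.trans hρ
  have hn0 : (0 : ℝ) < n := by
    rcases (Nat.cast_nonneg (α := ℝ) n).eq_or_lt with h | h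
    · rw [← h] at hn; simp at hn; linarith
    · exact h
  have hfilter : (Finset.univ.image x).filter (fun i : ℕ+ => ⌊(n : ℝ) ^ ρ⌋₊ < i) =
      (Finset.univ.image x).filter (fun i : ℕ+ => (n : ℝ) ^ ρ < ((i : ℕ) : ℝ)) :=
    Finset.filter_congr fun i _ => Nat.floor_lt (by positivity)
  rw [largeSymbolCost, hfilter, Finset.mul_sum, Finset.sum_mul, Finset.mul_sum]
  refine Finset.sum_le_sum fun i hi => ?_
  have hi := (Finset.mem_filter.1 hi).2
  have h3 : ρ * Real.log n ≤ Real.log (i : ℕ) := by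
    rw [← Real.log_rpow hn0]
    exact Real.log_le_log (by positivity) hi.le
  rw [Real.logb, mul_assoc (1 + 1 / ρ), div_mul_cancel₀ _ h2.ne']
  set u := Real.log (i : ℕ)
  have h4 : Real.log n ≤ 1 / ρ * u := by
    rw [one_div_mul_eq_div, le_div_iff₀ hρ0]; linarith
  have h5 : ε * Real.log n ≤ u := le_trans (by gcongr) h3
  have h6 : ε / 2 * (ε * Real.log n) ≤ ε / 2 * u := by gcongr
  have h7 : 0 ≤ ε * (1 / ρ * u) := mul_nonneg hε.le (by linarith)
  linarith

/-- Redundancy bound at a single exponent, for lengths `n` satisfying explicit conditions. -/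
theorem redundancy_nats_le {ε ρ C R : ℝ} {b : ℕ → ℝ} {n : ℕ} (hε : 0 < ε) (hρ : ε < ρ)
    (hC : 0 ≤ C) (hn : 1 ≤ Real.log n) (hn3 : 3 ≤ n) (hnε : 1 + ε ≤ ε * (n : ℝ) ^ ε / 2)
    (hlog : 11 + C ≤ ε * (2 / 3 * Real.log n) / 4)
    (hb : 0 ≤ b n → b n ^ 2 * Real.exp ((11 + C) / ε) ≤ n)
    (hP1 : 70 + C ≤ ε / 2 * Real.log n) (hP2 : 2 * (70 + C) ≤ n)
    (hP3 : (70 + C) ^ 2 * (1 + ε) ≤ 2 * ε * n)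
    (h1 : ⌊(n : ℝ) ^ ρ⌋₊ ≤ n → R ≤ ⌊(n : ℝ) ^ ρ⌋₊ * (Real.log (n / ⌊(n : ℝ) ^ ρ⌋₊) / 2) +
      6 * ⌊(n : ℝ) ^ ρ⌋₊ + 2 * Real.log (⌊(n : ℝ) ^ ρ⌋₊ + 2) + C)
    (h2 : ⌊(n : ℝ) ^ ρ⌋₊ ^ 2 ≤ n → R ≤ ⌊(n : ℝ) ^ ρ⌋₊ *
      Real.log (n / (⌊(n : ℝ) ^ ρ⌋₊ : ℝ) ^ 2) + 5 * ⌊(n : ℝ) ^ ρ⌋₊ +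
      2 * Real.log (⌊(n : ℝ) ^ ρ⌋₊ + 2) + C)
    (h3 : ∀ D : ℕ, 1 ≤ D → R ≤ (2 * (D * Nat.clog 2 (⌊(n : ℝ) ^ ρ⌋₊ * D)) + 1) * Real.log 2 +
      4 * n / D + 2 * Real.log (⌊(n : ℝ) ^ ρ⌋₊ + 2) + 2 * Real.log (D + 3) + C) :
    R ≤ (1 + ε) * (effectiveAlphabetCost ε b n ρ * Real.log 2) := by
  have hn1 : (1 : ℝ) < n := by exact_mod_cast (show 1 < n by omega)
  have hn0 : (0 : ℝ) < n := by linarith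
  have hρ0 : 0 < ρ := hε.trans hρ
  have hm : (1 : ℝ) ≤ (n : ℝ) ^ ρ := Real.one_le_rpow hn1.le hρ0.le
  have hMm := Nat.floor_le (show 0 ≤ (n : ℝ) ^ ρ by linarith)
  by_cases c1 : (n : ℝ) ^ ρ ≤ (n : ℝ) ^ (1 / 3 : ℝ)
  · rw [effectiveAlphabetCost_mul_log_two_of_le c1]
    have hρ3 : ρ ≤ 1 / 3 := (Real.rpow_le_rpow_left_iff hn1).1 c1
    have hMn : ⌊(n : ℝ) ^ ρ⌋₊ ≤ n := by
      refine Nat.floor_le_of_le ?_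
      have := Real.rpow_le_rpow_of_exponent_le hn1.le (show ρ ≤ 1 by linarith)
      simpa using this
    refine (h1 hMn).trans (smallAlphabet_cost_le hε hC hm hn0 ?_ ?_)
    · have := Real.rpow_le_rpow_of_exponent_le hn1.le hρ.le
      have h4 : ε * (n : ℝ) ^ ε ≤ ε * (n : ℝ) ^ ρ := by gcongr
      linarith
    · rw [Real.log_div hn0.ne' (by positivity), Real.log_rpow hn0]
      have h4 : ρ * Real.log n ≤ 1 / 3 * Real.log n := by gcongr
      have h5 : ε * (2 / 3 * Real.log n) ≤ ε * (Real.log n - ρ * Real.log n) := by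
        gcongr; linarith
      linarith
  by_cases c2 : (n : ℝ) ^ ρ ≤ b n
  · rw [effectiveAlphabetCost_mul_log_two_of_lt c1 c2]
    have hE := Real.exp_pos ((11 + C) / ε)
    have h4 : ((n : ℝ) ^ ρ) ^ 2 * Real.exp ((11 + C) / ε) ≤ n := by
      refine le_trans ?_ (hb (by linarith))
      gcongr
    have hE1 : 1 ≤ Real.exp ((11 + C) / ε) := Real.one_le_exp (by positivity)
    refine (h2 ?_).trans (mediumAlphabet_cost_le hε hC hm hn0 ?_)
    · have h5 : ((⌊(n : ℝ) ^ ρ⌋₊ : ℕ) : ℝ) ^ 2 ≤ n := by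
        calc ((⌊(n : ℝ) ^ ρ⌋₊ : ℕ) : ℝ) ^ 2 ≤ ((n : ℝ) ^ ρ) ^ 2 := by gcongr
          _ ≤ ((n : ℝ) ^ ρ) ^ 2 * Real.exp ((11 + C) / ε) := le_mul_of_one_le_right (by positivity) hE1
          _ ≤ n := h4
      exact_mod_cast h5
    · have h5 : (11 + C) / ε ≤ Real.log (n / ((n : ℝ) ^ ρ) ^ 2) := by
        rw [Real.le_log_iff_exp_le (by positivity), le_div_iff₀ (by positivity)]
        linarith
      rw [div_le_iff₀ hε] at h5
      linarith
  · have key : R ≤ effectiveAlphabetCost ε b n ρ * Real.log 2 := by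
      refine le_effectiveAlphabetCost c1 c2 fun α hα => ?_
      rcases le_or_gt 0 α with h | h
      · obtain ⟨D, hD, hD'⟩ := exists_precision_cost_le hC hn hρ0.le h
        exact (h3 D hD).trans (hD'.trans (le_tradeoffCost_of_nonneg hε h hα hn hP1))
      · obtain ⟨D, hD, hD'⟩ := exists_precision_cost_le hC hn hρ0.le le_rfl
        refine (h3 D hD).trans (hD'.trans ?_)
        simpa using le_tradeoffCost_of_neg hε hρ.le h (by linarith) hn hn3 hP2 hP3
    -- In this region the bound holds without the factor `1 + ε`; nonnegativity allows inserting it.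
    have h0 : 0 ≤ effectiveAlphabetCost ε b n ρ * Real.log 2 := by
      refine le_effectiveAlphabetCost c1 c2 fun α hα => ?_
      have hl : 0 ≤ Real.log n := by linarith
      rcases le_or_gt 0 α with h | h
      · refine le_trans ?_ (le_tradeoffCost_of_nonneg hε h hα hn hP1)
        positivity
      · refine le_trans ?_ (le_tradeoffCost_of_neg hε hρ.le h (P := 70 + C) (by linarith) hn hn3 hP2 hP3)
        positivity
    nlinarith

theorem theorem8 (ε : ℝ) (hε : 0 < ε) :
    ∃ L : (n : ℕ) → (Fin n → ℕ+) → ℝ,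
      (∀ n, IsCodeLength (L n)) ∧
      ∀ b : ℕ → ℝ, b =o[atTop] (fun n : ℕ => √(n : ℝ)) →
        ∀ᶠ n : ℕ in atTop, ∀ x : Fin n → ℕ+,
          individualRedundancy (L n) x ≤
            (1 + ε) / (n : ℝ) *
              ⨅ ρ : Set.Ioi ε,
                (effectiveAlphabetCost ε b n (ρ : ℝ)
                  + (1 + 1 / (ρ : ℝ)) * largeSymbolCost (ρ : ℝ) x) := by
  obtain ⟨C, hC, L, hL, hLbound⟩ := exists_universal_code (half_pos hε)
  refine ⟨L, hL, fun b hb => ?_⟩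
  have tcast : Tendsto (fun n : ℕ => (n : ℝ)) atTop atTop := tendsto_natCast_atTop_atTop
  have tlog : Tendsto (fun n : ℕ => Real.log n) atTop atTop := Real.tendsto_log_atTop.comp tcast
  have tpow : Tendsto (fun n : ℕ => (n : ℝ) ^ ε) atTop atTop := (tendsto_rpow_atTop hε).comp tcast
  set η := Real.exp (-((11 + C) / ε / 2)) with hη
  have hη2 : η ^ 2 * Real.exp ((11 + C) / ε) = 1 := by
    rw [hη, ← Real.exp_nat_mul, ← Real.exp_add]
    norm_num
    ring
  -- None of these conditions involves `ρ` or `x`, so the infimum can be taken for each fixed `n`.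
  filter_upwards [tlog.eventually_ge_atTop 1, eventually_ge_atTop 3,
    tpow.eventually_ge_atTop ((1 + ε) * 2 / ε), tlog.eventually_ge_atTop ((11 + C) * 6 / ε),
    hb.def (Real.exp_pos (-((11 + C) / ε / 2))), tlog.eventually_ge_atTop ((70 + C) * 2 / ε),
    tcast.eventually_ge_atTop (2 * (70 + C)),
    tcast.eventually_ge_atTop ((70 + C) ^ 2 * (1 + ε) / (2 * ε)),
    tlog.eventually_ge_atTop (2 * C / ε ^ 2)] with n hn hn3 hnε hlog hbn hP1 hP2 hP3 hCn x
  have hn1 : (1 : ℝ) < n := by exact_mod_cast (show 1 < n by omega)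
  have hn0 : (0 : ℝ) < n := by linarith
  rw [div_le_iff₀ (by positivity)] at hnε hlog hP1 hP3 hCn
  have hlog2 := Real.log_pos one_lt_two
  rw [individualRedundancy, one_div, div_mul_eq_mul_div, inv_mul_eq_div]
  refine div_le_div_of_nonneg_right ?_ hn0.le
  rw [← div_le_iff₀' (by linarith : 0 < 1 + ε)]
  have : Nonempty (Set.Ioi ε) := ⟨⟨ε + 1, by simp⟩⟩
  refine le_ciInf fun ρ => ?_
  obtain ⟨ρ, hρ⟩ := ρ
  have hρ' : ε < ρ := hρ
  simp only
  rw [div_le_iff₀' (by linarith : 0 < 1 + ε)]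
  refine le_of_mul_le_mul_right ?_ hlog2
  have hm : (1 : ℝ) ≤ (n : ℝ) ^ ρ := Real.one_le_rpow hn1.le (hε.trans hρ').le
  obtain ⟨h1, h2, h3⟩ := hLbound n ⌊(n : ℝ) ^ ρ⌋₊ x (Nat.le_floor (by simpa using hm))
  have hlarge := largeSymbolCost_nats_le hε hρ' hn (C := C) (by nlinarith) x
  set S := ∑ i ∈ (Finset.univ.image x).filter (fun i : ℕ+ => ⌊(n : ℝ) ^ ρ⌋₊ < i),
      (C + Real.log n + (1 + ε / 2) * Real.log (i : ℕ))
  have hmain := redundancy_nats_le (R := L n x * Real.log 2 + Real.log (monotonicML x) - S)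
    (b := b) hε hρ' hC hn hn3 (by linarith) (by linarith) ?_ (by linarith) hP2 (by linarith)
    (fun h => by linarith [h1 h]) (fun h => by linarith [h2 h]) (fun D hD => by linarith [h3 D hD])
  · have h4 : (L n x + Real.logb 2 (monotonicML x)) * Real.log 2 =
        L n x * Real.log 2 + Real.log (monotonicML x) := by
      rw [Real.logb]; field_simp
    rw [h4]
    linarith
  · intro hb0
    rw [Real.norm_of_nonneg hb0, Real.norm_of_nonneg (Real.sqrt_nonneg _)] at hbn
    calc b n ^ 2 * Real.exp ((11 + C) / ε) ≤ (η * √(n : ℝ)) ^ 2 * Real.exp ((11 + C) / ε) := by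
          gcongr
      _ = (η ^ 2 * Real.exp ((11 + C) / ε)) * n := by
          rw [mul_pow, Real.sq_sqrt hn0.le]; ring
      _ = n := by rw [hη2, one_mul]
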